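/- Let $q,\xi\in[0,1)$. For a partition $\lambda=(\lambda_1\ge\lambda_2\ge\cdots)$ (with $\lambda_i=0$ for large $i$) write $|\lambda|=\sum_i\lambda_i$, $b(\lambda)=\sum_{i\ge1}(i-1)\lambda_i$, and let $h(i,j)=\lambda_i+\lambda^{\mathrm T}_j-i-j+1$ be the hook length of a cell $(i,j)$ of $\lambda$, where $\lambda^{\mathrm T}$ is the transposed partition. Let $M(\xi;q)=\prod_{n\ge1}(1-\xi^2q^n)^{-n}$. The squared-type and the mixed-type $q$-Plancherel measures on the set of all partitions are (with $0^0=1$) $$\mu_S[\lambda]=M(\xi;q)^{-1}\,(\xi^2q)^{|\lambda|}\,q^{2b(\lambda)}\prod_{(i,j)\in\lambda}\frac1{(1-q^{h(i,j)})^2},$$ $$\mu_M[\lambda]=\exp\!\Big(-\frac{\xi^2}{1-q}\Big)\,\xi^{2|\lambda|}\,q^{b(\lambda)}\prod_{(i,j)\in\lambda}\frac1{h(i,j)\,(1-q^{h(i,j)})}.$$ Both are probability measures. Moreover, for each of the two measures $\mu$, the random point configuration $\Xi(\lambda)=\{\lambda_i-i+\tfrac12 : i\ge1\}\subset\mathbb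 Z+\tfrac12$, with $\lambda$ distributed according to $\mu$, is a discrete determinantal point process on $\mathbb Z+\tfrac12$: there is a kernel $K:(\mathbb Z+\tfrac12)^2\to\mathbb C$ such that for every $k\ge0$ and all distinct $z_1,\dots,z_k\in\mathbb Z+\tfrac12$, $$\mu\big[\{z_1,\dots,z_k\}\subset\Xi(\lambda)\big]=\det_{1\le i,j\le k}K(z_i,z_j).$$ -/

import Mathlib

open MeasureTheory

noncomputable section

/-! Partitions are Young diagrams, with rows and columns indexed from `0`:
`lam.rowLen i` is the part of index `i + 1`, `lam.colLen j` the part of index `j + 1` of the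
transposed partition, and `lam.card` is the size. -/

/-- `b(λ) = ∑_{i ≥ 1} (i - 1) λ_i`. -/
def bStat (lam : YoungDiagram) : ℕ :=
  ∑ i ∈ Finset.range (lam.colLen 0), i * lam.rowLen i

/-- The hook length of the cell `c = (i, j)` (indices from `0`). On cells of `lam` the
subtractions do not truncate. -/
def hookLength (lam : YoungDiagram) (c : ℕ × ℕ) : ℕ :=
  lam.rowLen c.1 + lam.colLen c.2 - c.1 - c.2 - 1

/-- The modified MacMahon function `M(ξ; q) = ∏_{n ≥ 1} (1 - ξ² qⁿ)⁻ⁿ`. -/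
def modMacMahon (ξ q : ℝ) : ℝ :=
  ∏' n : ℕ, 1 / (1 - ξ ^ 2 * q ^ (n + 1)) ^ (n + 1)

/-- The mass of `lam` under the squared type `q`-Plancherel measure. -/
def squaredWeight (ξ q : ℝ) (lam : YoungDiagram) : ℝ :=
  (modMacMahon ξ q)⁻¹ * (ξ ^ 2 * q) ^ lam.card * q ^ (2 * bStat lam) *
    ∏ c ∈ lam.cells, 1 / (1 - q ^ hookLength lam c) ^ 2

/-- The mass of `lam` under the mixed type `q`-Plancherel measure. -/
def mixedWeight (ξ q : ℝ) (lam : YoungDiagram) : ℝ :=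
  Real.exp (-(ξ ^ 2 / (1 - q))) * ξ ^ (2 * lam.card) * q ^ bStat lam *
    ∏ c ∈ lam.cells, 1 / ((hookLength lam c : ℝ) * (1 - q ^ hookLength lam c))

/-- Every set of partitions is measurable. -/
instance : MeasurableSpace YoungDiagram := ⊤

/-- The measure on partitions with the given (nonnegative) point masses. -/
def partitionMeasure (w : YoungDiagram → ℝ) : Measure YoungDiagram :=
  Measure.sum fun lam => ENNReal.ofReal (w lam) • Measure.dirac lam

/-- The squared type `q`-Plancherel measure. -/
def squaredQPlancherel (ξ q : ℝ) : Measure YoungDiagram :=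
  partitionMeasure (squaredWeight ξ q)

/-- The mixed type `q`-Plancherel measure. -/
def mixedQPlancherel (ξ q : ℝ) : Measure YoungDiagram :=
  partitionMeasure (mixedWeight ξ q)

/-- The lattice `ℤ + 1/2`. -/
abbrev HalfInt : Type := {x : ℚ // ∃ n : ℤ, x = (n : ℚ) + 1 / 2}

/-- The point configuration `{λ_i - i + 1/2 : i ≥ 1}` of a partition, a subset of `ℤ + 1/2`
(with `i` replaced by `i + 1`, as rows are indexed from `0`). -/
def configuration (lam : YoungDiagram) : Set HalfInt :=
  {x | ∃ i : ℕ, (x : ℚ) = (lam.rowLen i : ℚ) - ((i : ℚ) + 1) + 1 / 2}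

/-- The law of the random point configuration `configuration lam`, with `lam` distributed
according to `μ`; sets of configurations carry the product (cylinder) `σ`-algebra. -/
def configurationLaw (μ : Measure YoungDiagram) : Measure (Set HalfInt) :=
  μ.map configuration

/-- The correlation function `ρ(Z) = P(Z ⊆ S)` of a random subset `S` with law `P`. -/
def correlationFunction {E : Type*} (P : Measure (Set E)) (Z : Finset E) : ℝ :=
  P.real {S : Set E | (Z : Set E) ⊆ S}

/-- A (simple) point process on a discrete space `E`, given by its law `P` on subsets of `E`, is
determinantal if there is one kernel `K` on `E × E` such that, for every `k` and all distinct
points `z_1, …, z_k`, the `k`-point correlation function is the determinant of the matrix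
`K(z_i, z_j)`. -/
def IsDiscreteDeterminantal {E : Type*} (P : Measure (Set E)) : Prop :=
  IsProbabilityMeasure P ∧
    ∃ K : E → E → ℂ, ∀ (k : ℕ) (z : Fin k ↪ E),
      ((correlationFunction P (Finset.univ.map z) : ℝ) : ℂ) =
        (Matrix.of fun i j : Fin k => K (z i) (z j)).det

end

/-! Both measures are Schur measures: up to the normalizing constant, the mass of λ is s_λ(ρ₁)
s_λ(ρ₂). The factors are principal specializations x^|λ| q^b(λ) ∏ 1/[h]_q (`schurWeight`); the
second factor of the mixed measure has q = 1, where [h]_1 = h.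

Determinantal structure. Partitions with at most N rows correspond to N distinct particle positions,
and by Jacobi–Trudi s_λ is an N × N minor whose rows are these positions
(`det_jacobiTrudi_completeHomog`). Restricted to a box, the measure is therefore a biorthogonal
ensemble, and its correlations are minors of U (V U)⁻¹ V (`sum_subset_range_eq_det`). No explicit
limit kernel is computed: the entries of all box kernels are bounded by half of ∑ s_λ(ρ₁)² + ∑
s_λ(ρ₂)² (`abs_kernel_mul_det_le`), so they converge along an ultrafilter, and determinants and box
sums pass to the limit (`exists_kernel_schurWeight`). Both sums of squares are finite once the
parameters, of which only the product x y matters, are balanced between the factors.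

Normalization. The Cauchy identity is proved for the variables 1, q, …, q^(N-1) by Cauchy–Binet
against a Vandermonde matrix, and then N → ∞ (`hasSum_schurWeight_mul`). The generating series of
the second factor is exp in the mixed case and the q-exponential in the squared case, which yield
the exponential and the MacMahon constant. -/

noncomputable section

open Filter Topology Finset

/-! ### Partitions as increasing particle positions -/

/-- The positions of the first `N` particles of a partition, shifted to be nonnegative and listed
increasingly. -/
def particlePos (N : ℕ) (lam : YoungDiagram) (i : Fin N) : ℕ :=
  lam.rowLen (N - 1 - i) + i

theorem YoungDiagram.rowLen_eq_zero_of_colLen_le {lam : YoungDiagram} {i : ℕ}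
    (h : lam.colLen 0 ≤ i) : lam.rowLen i = 0 := by
  by_contra h0
  have : (i, 0) ∈ lam := YoungDiagram.mem_iff_lt_rowLen.2 (Nat.pos_of_ne_zero h0)
  have := YoungDiagram.mem_iff_lt_colLen.1 this
  omega

theorem YoungDiagram.eq_of_rowLen_eq {lam mu : YoungDiagram} (h : ∀ i, lam.rowLen i = mu.rowLen i) :
    lam = mu := by
  ext ⟨i, j⟩
  rw [YoungDiagram.mem_cells, YoungDiagram.mem_cells, YoungDiagram.mem_iff_lt_rowLen,
    YoungDiagram.mem_iff_lt_rowLen, h]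

theorem particlePos_strictMono (N : ℕ) (lam : YoungDiagram) : StrictMono (particlePos N lam) := by
  intro a b hab
  have h1 : (a : ℕ) < b := hab
  have := lam.rowLen_anti (N - 1 - b) (N - 1 - a) (by omega)
  simp only [particlePos]
  omega

theorem eq_of_particlePos_eq {N : ℕ} {lam mu : YoungDiagram} (hl : lam.colLen 0 ≤ N)
    (hm : mu.colLen 0 ≤ N) (h : particlePos N lam = particlePos N mu) : lam = mu := by
  apply YoungDiagram.eq_of_rowLen_eq
  intro i
  by_cases hi : i < N
  · have := congrFun h ⟨N - 1 - i, by omega⟩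
    simp only [particlePos] at this
    have h2 : N - 1 - (N - 1 - i) = i := by omega
    rw [h2] at this
    omega
  · rw [YoungDiagram.rowLen_eq_zero_of_colLen_le (by omega),
      YoungDiagram.rowLen_eq_zero_of_colLen_le (by omega)]

theorem StrictMono.add_sub_le {N : ℕ} {s : Fin N → ℕ} (hs : StrictMono s) {a b : ℕ} (hab : a ≤ b)
    (hb : b < N) : s ⟨a, by omega⟩ + (b - a) ≤ s ⟨b, hb⟩ := by
  induction b, hab using Nat.le_induction with
  | base => simp
  | succ b hab ih =>
    have h1 := ih (by omega)
    have h2 : s ⟨b, by omega⟩ < s ⟨b + 1, hb⟩ := hs (by simp [Fin.lt_def])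
    omega

/-- The parts are recovered by subtracting a from s a and reversing the order; strict monotonicity
makes them nonnegative and weakly decreasing. -/
theorem exists_particlePos_eq {N : ℕ} {s : Fin N → ℕ} (hs : StrictMono s) :
    ∃ lam : YoungDiagram, lam.colLen 0 ≤ N ∧ particlePos N lam = s := by
  classical
  -- Row i has length s (N-1-i) - (N-1-i), written additively to avoid truncation. The sum of s is
  -- only a crude bound on the columns, to make the set finite.
  let C : Finset (ℕ × ℕ) := (range N ×ˢ range (∑ i, s i)).filter
    fun c => ∃ h : c.1 < N, c.2 + (N - 1 - c.1) < s ⟨N - 1 - c.1, by omega⟩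
  have hC : ∀ i j, (i, j) ∈ C ↔ ∃ h : i < N, j + (N - 1 - i) < s ⟨N - 1 - i, by omega⟩ := by
    intro i j
    simp only [C, mem_filter, mem_product, mem_range]
    refine ⟨fun h => h.2, fun h => ⟨⟨h.1, ?_⟩, h⟩⟩
    obtain ⟨h1, h2⟩ := h
    have := Finset.single_le_sum (f := s) (fun _ _ => Nat.zero_le _)
      (mem_univ (⟨N - 1 - i, by omega⟩ : Fin N))
    omega
  have hlow : IsLowerSet (C : Set (ℕ × ℕ)) := by
    rintro ⟨i, j⟩ ⟨i', j'⟩ hle hc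
    obtain ⟨h1, h2⟩ := Prod.mk_le_mk.1 hle
    rw [mem_coe, hC] at hc ⊢
    obtain ⟨h3, h4⟩ := hc
    refine ⟨by omega, ?_⟩
    have := hs.add_sub_le (a := N - 1 - i) (b := N - 1 - i') (by omega) (by omega)
    omega
  let lam : YoungDiagram := ⟨C, hlow⟩
  have hmem : ∀ i j, (i, j) ∈ lam ↔ ∃ h : i < N, j + (N - 1 - i) < s ⟨N - 1 - i, by omega⟩ := hC
  refine ⟨lam, ?_, ?_⟩
  · by_contra! h
    have := YoungDiagram.mem_iff_lt_colLen.2 h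
    obtain ⟨h', -⟩ := (hmem _ _).1 this
    omega
  · ext a
    have hrow : ∀ j, j < lam.rowLen (N - 1 - a) ↔ j + a < s a := by
      intro j
      rw [← YoungDiagram.mem_iff_lt_rowLen, hmem]
      have ha := a.2
      have h2 : N - 1 - (N - 1 - (a : ℕ)) = a := by omega
      simp only [h2, Fin.eta]
      exact ⟨fun h => h.2, fun h => ⟨by omega, h⟩⟩
    have ha : (a : ℕ) ≤ s a := by
      have := hs.add_sub_le (a := 0) (b := a) (by omega) a.2
      simp only [Fin.eta] at this
      omega
    have h3 := hrow (lam.rowLen (N - 1 - a))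
    have h4 := hrow (s a - a)
    have h5 := hrow (s a - a - 1)
    simp only [particlePos]
    omega

theorem finite_setOf_box (N L : ℕ) :
    {lam : YoungDiagram | lam.colLen 0 ≤ N ∧ lam.rowLen 0 + N ≤ L}.Finite := by
  have hinj : Function.Injective YoungDiagram.cells := fun a b h => YoungDiagram.ext h
  refine Set.Finite.subset ((range N ×ˢ range L).powerset.finite_toSet.preimage hinj.injOn) ?_
  rintro lam ⟨h1, h2⟩
  simp only [Set.mem_preimage, mem_coe, mem_powerset]
  rintro ⟨i, j⟩ hc
  rw [YoungDiagram.mem_cells] at hc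
  have h3 := YoungDiagram.mem_iff_lt_colLen.1 (lam.up_left_mem le_rfl (Nat.zero_le j) hc)
  have h4 := YoungDiagram.mem_iff_lt_rowLen.1 (lam.up_left_mem (Nat.zero_le i) le_rfl hc)
  simp only [mem_product, mem_range]
  omega

/-- The partitions with at most `N` rows and at most `L - N` columns. -/
def partitionBox (N L : ℕ) : Finset YoungDiagram := (finite_setOf_box N L).toFinset

theorem mem_partitionBox {N L : ℕ} {lam : YoungDiagram} :
    lam ∈ partitionBox N L ↔ lam.colLen 0 ≤ N ∧ lam.rowLen 0 + N ≤ L := by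
  simp [partitionBox]

theorem particlePos_lt {N L : ℕ} {lam : YoungDiagram} (h : lam ∈ partitionBox N L) (i : Fin N) :
    particlePos N lam i < L := by
  have h1 := (mem_partitionBox.1 h).2
  have := lam.rowLen_anti 0 (N - 1 - i) (Nat.zero_le _)
  have := i.2
  simp only [particlePos]
  omega

theorem mem_partitionBox_of_particlePos_lt {N L : ℕ} (hNL : N ≤ L) {lam : YoungDiagram}
    (h : lam.colLen 0 ≤ N)
    (h2 : ∀ i, particlePos N lam i < L) : lam ∈ partitionBox N L := by
  refine mem_partitionBox.2 ⟨h, ?_⟩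
  rcases Nat.eq_zero_or_pos N with rfl | hN
  · rw [YoungDiagram.rowLen_eq_zero_of_colLen_le h]
    omega
  · have := h2 ⟨N - 1, by omega⟩
    simp only [particlePos, Nat.sub_self] at this
    omega

/-- A sum of a symmetric function over tuples, written as a sum over partitions in a box. -/
theorem sum_tuples_eq_sum_partitionBox {N L : ℕ} (hNL : N ≤ L) (F : (Fin N → ℕ) → ℝ)
    (hsymm : ∀ (s : Fin N → ℕ) (σ : Equiv.Perm (Fin N)), F (s ∘ σ) = F s)
    (hinj : ∀ s : Fin N → ℕ, ¬ Function.Injective s → F s = 0) :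
    ∑ s : Fin N → Fin L, F (fun i => s i) =
      (N.factorial : ℝ) * ∑ lam ∈ partitionBox N L, F (particlePos N lam) := by
  classical
  have h1 : ∑ s : Fin N → Fin L, F (fun i => s i) =
      ∑ s ∈ univ.filter (fun s : Fin N → Fin L => Function.Injective s), F (fun i => s i) := by
    symm
    apply Finset.sum_subset (Finset.subset_univ _)
    intro s _ hs
    simp only [mem_filter, mem_univ, true_and] at hs
    apply hinj
    intro h
    exact hs (fun a b hab => h (by simpa using congrArg Fin.val hab))
  have h2 : (N.factorial : ℝ) * ∑ lam ∈ partitionBox N L, F (particlePos N lam) =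
      ∑ p ∈ partitionBox N L ×ˢ (univ : Finset (Equiv.Perm (Fin N))), F (particlePos N p.1) := by
    rw [Finset.sum_product, Finset.mul_sum]
    refine Finset.sum_congr rfl fun lam _ => ?_
    simp [Finset.card_univ, Fintype.card_perm]
  rw [h1, h2]
  symm
  -- An injective tuple is an increasing one composed with a unique permutation, found by sorting.
  refine Finset.sum_bij
    (fun p hp i => ⟨particlePos N p.1 (p.2 i), particlePos_lt (mem_product.1 hp).1 _⟩) ?_ ?_ ?_ ?_
  · rintro ⟨lam, σ⟩ hp
    simp only [mem_filter, mem_univ, true_and]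
    intro a b hab
    exact σ.injective ((particlePos_strictMono N lam).injective (by simpa using hab))
  · rintro ⟨lam, σ⟩ hp ⟨mu, τ⟩ hp' h
    simp only [mem_product, mem_univ, and_true] at hp hp'
    have h' : particlePos N lam ∘ σ = particlePos N mu ∘ τ := by
      ext i
      simpa using congrFun h i
    have hr : Set.range (particlePos N lam) = Set.range (particlePos N mu) := by
      rw [← σ.surjective.range_comp, h', τ.surjective.range_comp]
    have he : particlePos N lam = particlePos N mu :=
      ((particlePos_strictMono N lam).range_inj (particlePos_strictMono N mu)).1 hr
    have hlm := eq_of_particlePos_eq (mem_partitionBox.1 hp).1 (mem_partitionBox.1 hp').1 he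
    subst hlm
    congr 1
    ext i
    have := (particlePos_strictMono N lam).injective (congrFun h' i)
    rw [this]
  · intro s hs
    simp only [mem_filter, mem_univ, true_and] at hs
    have hmono : StrictMono (fun i => ((s (Tuple.sort s i) : Fin L) : ℕ)) := by
      have hm : Monotone (s ∘ Tuple.sort s) := Tuple.monotone_sort s
      have : StrictMono (s ∘ Tuple.sort s) :=
        hm.strictMono_of_injective (hs.comp (Tuple.sort s).injective)
      exact fun a b hab => this hab
    obtain ⟨lam, hlam, hpos⟩ := exists_particlePos_eq hmono
    refine ⟨(lam, (Tuple.sort s)⁻¹), ?_, ?_⟩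
    · simp only [mem_product, mem_univ, and_true]
      apply mem_partitionBox_of_particlePos_lt hNL hlam
      intro i
      rw [hpos]
      exact (s _).2
    · ext i
      simp [hpos]
  · rintro ⟨lam, σ⟩ hp
    exact (hsymm (particlePos N lam) σ).symm

/-- The half-integer corresponding to the shifted position `l`. -/
def siteOf (N l : ℕ) : HalfInt := ⟨((l : ℤ) - N : ℤ) + 1 / 2, _, rfl⟩

theorem siteOf_mem_configuration {N l : ℕ} {lam : YoungDiagram} (h : lam.colLen 0 ≤ N) :
    siteOf N l ∈ configuration lam ↔ l ∈ Set.range (particlePos N lam) := by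
  simp only [configuration, siteOf, Set.mem_ofPred_eq, Set.mem_range]
  have key : ∀ i : ℕ, ((((l : ℤ) - N : ℤ) : ℚ) + 1 / 2 =
      (lam.rowLen i : ℚ) - ((i : ℚ) + 1) + 1 / 2) ↔ l + i + 1 = lam.rowLen i + N := by
    intro i
    rw [← Nat.cast_inj (R := ℚ)]
    push_cast
    constructor <;> intro h <;> linarith
  simp only [key]
  constructor
  · rintro ⟨i, hi⟩
    have hiN : i < N := by
      by_contra hc
      rw [YoungDiagram.rowLen_eq_zero_of_colLen_le (by omega)] at hi
      omega
    refine ⟨⟨N - 1 - i, by omega⟩, ?_⟩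
    have h2 : N - 1 - (N - 1 - i) = i := by omega
    simp only [particlePos, h2]
    omega
  · rintro ⟨a, ha⟩
    refine ⟨N - 1 - a, ?_⟩
    simp only [particlePos] at ha
    have := a.2
    omega

/-! ### Hook lengths, q-factorials and the Jacobi–Trudi determinant -/

/-- In row `i`, the hook lengths and the differences of particle positions together exhaust
`1, …, lam.rowLen i + (N - 1 - i)`. -/
theorem prod_row_hookLength_mul_prod_sub {N : ℕ} {lam : YoungDiagram} (h : lam.colLen 0 ≤ N)
    (f : ℕ → ℝ) (a : Fin N) :
    (∏ j ∈ range (lam.rowLen (N - 1 - a)), f (hookLength lam (N - 1 - a, j))) *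
      ∏ b ∈ Finset.Iio a, f (particlePos N lam a - particlePos N lam b) =
      ∏ m ∈ range (particlePos N lam a), f (m + 1) := by
  classical
  set i := N - 1 - (a : ℕ) with hi
  have haN := a.2
  have hcol : ∀ j, lam.colLen j ≤ N := fun j => (lam.colLen_anti 0 j (Nat.zero_le j)).trans h
  have hA : ∀ j, j < lam.rowLen i → i < lam.colLen j := fun j hj =>
    YoungDiagram.mem_iff_lt_colLen.1 (YoungDiagram.mem_iff_lt_rowLen.2 hj)
  have hhl : ∀ j, j < lam.rowLen i →
      hookLength lam (i, j) + i + j + 1 = lam.rowLen i + lam.colLen j := by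
    intro j hj
    have := hA j hj
    simp only [hookLength]
    omega
  have hinj1 : Set.InjOn (fun j => hookLength lam (i, j)) (range (lam.rowLen i) : Set ℕ) := by
    intro j hj j' hj' hjj
    simp only [coe_range, Set.mem_Iio] at hj hj'
    have e1 := hhl j hj
    have e2 := hhl j' hj'
    simp only at hjj
    rcases le_total j j' with hle | hle
    · have := lam.colLen_anti j j' hle
      omega
    · have := lam.colLen_anti j' j hle
      omega
  have hlt : ∀ b, b < a → particlePos N lam b < particlePos N lam a :=
    fun b hb => particlePos_strictMono N lam hb
  have hinj2 : Set.InjOn (fun b => particlePos N lam a - particlePos N lam b)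
      (Finset.Iio a : Set (Fin N)) := by
    intro b hb c hc hbc
    simp only [coe_Iio, Set.mem_Iio] at hb hc
    have := hlt b hb
    have := hlt c hc
    apply (particlePos_strictMono N lam).injective
    simp only at hbc
    omega
  have hdisj : Disjoint ((range (lam.rowLen i)).image fun j => hookLength lam (i, j))
      ((Finset.Iio a).image fun b => particlePos N lam a - particlePos N lam b) := by
    rw [Finset.disjoint_left]
    intro m hm1 hm2
    simp only [mem_image, mem_range, mem_Iio] at hm1 hm2
    obtain ⟨j, hj, rfl⟩ := hm1
    obtain ⟨b, hb, hbm⟩ := hm2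
    have e1 := hhl j hj
    have e2 := hlt b hb
    have hb' : (b : ℕ) < a := hb
    -- Let i' = N-1-b. A coincidence would force colLen j - i' - 1 = j - rowLen i'. Whether or not
    -- (i', j) is a cell, one side is negative and the other is not.
    have e3 : (N - 1 - (b : ℕ), j) ∈ lam ↔ _ := YoungDiagram.mem_iff_lt_colLen
    have e4 : (N - 1 - (b : ℕ), j) ∈ lam ↔ _ := YoungDiagram.mem_iff_lt_rowLen
    simp only [particlePos] at hbm e2
    rw [e3] at e4
    rw [← hi] at hbm e2
    omega
  have hun : ((range (lam.rowLen i)).image fun j => hookLength lam (i, j)) ∪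
      ((Finset.Iio a).image fun b => particlePos N lam a - particlePos N lam b) =
      (range (particlePos N lam a)).image (· + 1) := by
    -- Both sides have rowLen i + a elements, so containment suffices.
    apply Finset.eq_of_subset_of_card_le
    · intro m hm
      simp only [mem_union, mem_image, mem_range, mem_Iio] at hm ⊢
      refine ⟨m - 1, ?_⟩
      rcases hm with ⟨j, hj, rfl⟩ | ⟨b, hb, rfl⟩
      · have e1 := hhl j hj
        have e2 := hA j hj
        have e3 := hcol j
        simp only [particlePos, ← hi]
        omega
      · have := hlt b hb
        omega
    · rw [Finset.card_union_of_disjoint hdisj, Finset.card_image_of_injOn hinj1,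
        Finset.card_image_of_injOn hinj2, Finset.card_image_of_injective _ (add_left_injective 1)]
      simp only [card_range, Fin.card_Iio, particlePos, ← hi]
      exact le_rfl
  rw [← Finset.prod_image (g := fun j => hookLength lam (i, j)) (f := f) hinj1,
    ← Finset.prod_image (f := f) hinj2, ← Finset.prod_union hdisj, hun,
    Finset.prod_image (add_left_injective 1).injOn]

/-- The `q`-number `1 + q + ⋯ + q ^ (k - 1)`. -/
def qNum (q : ℝ) (k : ℕ) : ℝ := ∑ i ∈ range k, q ^ i

/-- The `q`-factorial. -/
def qFact (q : ℝ) (n : ℕ) : ℝ := ∏ m ∈ range n, qNum q (m + 1)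

/-- The principal specialization `q ^ b(lam) / ∏ [h]_q` of a Schur function. -/
def hookWeight (q : ℝ) (lam : YoungDiagram) : ℝ :=
  q ^ bStat lam * ∏ c ∈ lam.cells, 1 / qNum q (hookLength lam c)

/-- The matrix with entries `h (s i - j)`, where `h` vanishes at negative arguments. -/
def jacobiTrudi (h : ℕ → ℝ) {N : ℕ} (s : Fin N → ℕ) : Matrix (Fin N) (Fin N) ℝ :=
  Matrix.of fun i j => if (j : ℕ) ≤ s i then h (s i - j) else 0

theorem one_le_qNum {q : ℝ} (hq : 0 ≤ q) {k : ℕ} (hk : k ≠ 0) : 1 ≤ qNum q k := by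
  obtain ⟨n, rfl⟩ := Nat.exists_eq_succ_of_ne_zero hk
  rw [qNum, Finset.sum_range_succ']
  have : 0 ≤ ∑ i ∈ range n, q ^ (i + 1) := Finset.sum_nonneg fun i _ => by positivity
  simp only [pow_zero]
  linarith

theorem one_le_qFact {q : ℝ} (hq : 0 ≤ q) (n : ℕ) : 1 ≤ qFact q n := by
  rw [qFact]
  calc (1 : ℝ) = ∏ m ∈ range n, (1 : ℝ) := by simp
    _ ≤ _ := Finset.prod_le_prod (fun _ _ => zero_le_one)
      fun m _ => one_le_qNum hq (Nat.succ_ne_zero m)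

theorem qFact_pos {q : ℝ} (hq : 0 ≤ q) (n : ℕ) : 0 < qFact q n :=
  zero_lt_one.trans_le (one_le_qFact hq n)

theorem qFact_succ (q : ℝ) (n : ℕ) : qFact q (n + 1) = qFact q n * qNum q (n + 1) := by
  simp [qFact, Finset.prod_range_succ]

theorem hookLength_pos {lam : YoungDiagram} {c : ℕ × ℕ} (hc : c ∈ lam.cells) :
    0 < hookLength lam c := by
  obtain ⟨i, j⟩ := c
  have h1 := YoungDiagram.mem_iff_lt_rowLen.1 ((YoungDiagram.mem_cells _).1 hc)
  have h2 := YoungDiagram.mem_iff_lt_colLen.1 ((YoungDiagram.mem_cells _).1 hc)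
  simp only [hookLength]
  omega

theorem hookWeight_nonneg {q : ℝ} (hq : 0 ≤ q) (lam : YoungDiagram) : 0 ≤ hookWeight q lam := by
  refine mul_nonneg (by positivity) (Finset.prod_nonneg fun c hc => ?_)
  have := one_le_qNum hq (hookLength_pos hc).ne'
  positivity

theorem pow_mul_qNum (q : ℝ) {a b : ℕ} (h : b ≤ a) :
    q ^ b * qNum q (a - b) = qNum q a - qNum q b := by
  obtain ⟨d, rfl⟩ := Nat.exists_eq_add_of_le h
  simp only [qNum, Nat.add_sub_cancel_left, Finset.sum_range_add, Finset.mul_sum, pow_add]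
  ring

/-- Since q^k [l-k] = [l] - [k], the q-analogue of l!/(l-j)! is a monic polynomial of degree j in
[l]. This is what turns Jacobi–Trudi into a Vandermonde determinant. For l < j both sides vanish,
the right one through its factor k = l. -/
theorem qFact_falling {q : ℝ} (hq : 0 ≤ q) (l j : ℕ) :
    (if j ≤ l then 1 / qFact q (l - j) else 0) * qFact q l * q ^ (∑ k ∈ range j, k) =
      ∏ k ∈ range j, (qNum q l - qNum q k) := by
  induction j with
  | zero => simp [(qFact_pos hq l).ne']
  | succ j ih =>
    rw [Finset.prod_range_succ, ← ih, Finset.sum_range_succ, pow_add]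
    rcases lt_trichotomy l j with h | h | h
    · rw [if_neg (by omega), if_neg (by omega)]
      ring
    · subst h
      simp
    · rw [if_pos (by omega), if_pos (by omega), ← pow_mul_qNum q h.le]
      obtain ⟨d, rfl⟩ := Nat.exists_eq_add_of_lt h
      have e1 : j + d + 1 - (j + 1) = d := by omega
      have e2 : j + d + 1 - j = d + 1 := by omega
      rw [e1, e2, qFact_succ q d]
      have h1 := (qFact_pos hq d).ne'
      have h2 : qNum q (d + 1) ≠ 0 := (zero_lt_one.trans_le (one_le_qNum hq (Nat.succ_ne_zero d))).ne'
      field_simp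

theorem bStat_eq_sum {N : ℕ} {lam : YoungDiagram} (h : lam.colLen 0 ≤ N) :
    bStat lam = ∑ i ∈ range N, i * lam.rowLen i := by
  rw [bStat]
  apply Finset.sum_subset (Finset.range_mono h)
  intro i _ hi
  rw [YoungDiagram.rowLen_eq_zero_of_colLen_le (by simpa using hi), mul_zero]

theorem prod_cells_eq {N : ℕ} {lam : YoungDiagram} (h : lam.colLen 0 ≤ N) (f : ℕ × ℕ → ℝ) :
    ∏ c ∈ lam.cells, f c =
      ∏ a : Fin N, ∏ j ∈ range (lam.rowLen (N - 1 - a)), f (N - 1 - a, j) := by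
  rw [Finset.prod_finset_product lam.cells (range N) (fun i => range (lam.rowLen i))]
  · rw [← Finset.prod_range_reflect,
      Finset.prod_range (fun i => ∏ j ∈ range (lam.rowLen (N - 1 - i)), f (N - 1 - i, j))]
  · rintro ⟨i, j⟩
    rw [YoungDiagram.mem_cells, mem_range, mem_range]
    refine ⟨fun hc => ⟨?_, YoungDiagram.mem_iff_lt_rowLen.1 hc⟩,
      fun hc => YoungDiagram.mem_iff_lt_rowLen.2 hc.2⟩
    have h3 := YoungDiagram.mem_iff_lt_colLen.1 (lam.up_left_mem le_rfl (Nat.zero_le j) hc)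
    exact h3.trans_le h

theorem card_add_sum_eq {N : ℕ} {lam : YoungDiagram} (h : lam.colLen 0 ≤ N) :
    lam.card + ∑ a : Fin N, (a : ℕ) = ∑ a, particlePos N lam a := by
  simp only [particlePos, Finset.sum_add_distrib, Nat.add_right_cancel_iff]
  rw [← Finset.sum_range (fun i => lam.rowLen (N - 1 - i)),
    Finset.sum_range_reflect (fun i => lam.rowLen i) N, YoungDiagram.card, Finset.card_eq_sum_ones,
    Finset.sum_finset_product lam.cells (range N) (fun i => range (lam.rowLen i))]
  · simp
  · rintro ⟨i, j⟩
    rw [YoungDiagram.mem_cells, mem_range, mem_range]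
    refine ⟨fun hc => ⟨?_, YoungDiagram.mem_iff_lt_rowLen.1 hc⟩,
      fun hc => YoungDiagram.mem_iff_lt_rowLen.2 hc.2⟩
    have h3 := YoungDiagram.mem_iff_lt_colLen.1 (lam.up_left_mem le_rfl (Nat.zero_le j) hc)
    exact h3.trans_le h

theorem det_vandermonde_eq_prod_Iio {N : ℕ} (v : Fin N → ℝ) :
    (Matrix.vandermonde v).det = ∏ a, ∏ b ∈ Finset.Iio a, (v a - v b) := by
  rw [Matrix.det_vandermonde]
  apply Finset.prod_comm'
  simp

/-- The double product of `q ^ (position)` over pairs, in terms of `bStat`. -/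
theorem prod_pow_particlePos (q : ℝ) {N : ℕ} {lam : YoungDiagram} (h : lam.colLen 0 ≤ N) :
    ∏ a : Fin N, ∏ b ∈ Finset.Iio a, q ^ particlePos N lam b =
      q ^ bStat lam * ∏ a : Fin N, q ^ (∑ k ∈ range a, k) := by
  have h1 : ∑ a : Fin N, ∑ b ∈ Finset.Iio a, lam.rowLen (N - 1 - b) = bStat lam := by
    rw [bStat_eq_sum h, ← Finset.sum_range_reflect,
      Finset.sum_range (fun i => (N - 1 - i) * lam.rowLen (N - 1 - i)),
      Finset.sum_comm' (t' := univ) (s' := fun b => Finset.Ioi b) (by simp)]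
    refine Finset.sum_congr rfl fun b _ => ?_
    rw [Finset.sum_const, Fin.card_Ioi, smul_eq_mul]
  have h2 : ∀ a : Fin N, ∑ b ∈ Finset.Iio a, (b : ℕ) = ∑ k ∈ range a, k := by
    intro a
    refine Finset.sum_bij (fun b _ => (b : ℕ)) ?_ ?_ ?_ ?_
    · intro b hb
      simpa using hb
    · intro b _ c _ hbc
      exact Fin.ext hbc
    · intro k hk
      have hk' := mem_range.1 hk
      exact ⟨⟨k, hk'.trans a.2⟩, by simpa [Fin.lt_def] using hk', rfl⟩
    · intro b _
      rfl
  simp only [Finset.prod_pow_eq_pow_sum, particlePos]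
  simp only [Finset.sum_add_distrib, h1, h2]
  rw [pow_add]

/-- Each factor [l_a] - [l_b] equals q^(l_b) [l_a - l_b]. The powers of q collect into q^b(λ), and
the remaining differences are, row by row, a q-factorial divided by the hooks. -/
theorem det_vandermonde_qNum_particlePos (q : ℝ) {N : ℕ} {lam : YoungDiagram}
    (hq : 0 ≤ q) (h : lam.colLen 0 ≤ N) :
    (Matrix.vandermonde fun a => qNum q (particlePos N lam a)).det =
      hookWeight q lam * (∏ a : Fin N, q ^ (∑ k ∈ range a, k)) *
        ∏ a, qFact q (particlePos N lam a) := by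
  have hh : ∏ a, qFact q (particlePos N lam a) =
      (∏ c ∈ lam.cells, qNum q (hookLength lam c)) *
        ∏ a, ∏ b ∈ Finset.Iio a, qNum q (particlePos N lam a - particlePos N lam b) := by
    rw [prod_cells_eq h, ← Finset.prod_mul_distrib]
    exact Finset.prod_congr rfl fun a _ => (prod_row_hookLength_mul_prod_sub h (qNum q) a).symm
  have hne : ∏ c ∈ lam.cells, qNum q (hookLength lam c) ≠ 0 :=
    Finset.prod_ne_zero_iff.2 fun c hc =>
      (zero_lt_one.trans_le (one_le_qNum hq (hookLength_pos hc).ne')).ne'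
  rw [det_vandermonde_eq_prod_Iio]
  have h1 : ∀ a, ∀ b ∈ Finset.Iio a, qNum q (particlePos N lam a) - qNum q (particlePos N lam b) =
      q ^ particlePos N lam b * qNum q (particlePos N lam a - particlePos N lam b) := by
    intro a b hb
    rw [pow_mul_qNum q (particlePos_strictMono N lam (Finset.mem_Iio.1 hb)).le]
  rw [Finset.prod_congr rfl fun a _ => Finset.prod_congr rfl (h1 a)]
  simp only [Finset.prod_mul_distrib]
  rw [prod_pow_particlePos q h, hh, hookWeight, Finset.prod_div_distrib, Finset.prod_const_one]
  field_simp

/-- Column j is a monic polynomial of degree j, so it differs from the j-th power by a unitriangular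
column operation. -/
theorem det_prod_sub_eq_det_vandermonde {N : ℕ} (v : Fin N → ℝ) (x : ℕ → ℝ) :
    (Matrix.of fun i j : Fin N => ∏ k ∈ range j, (v i - x k)).det =
      (Matrix.vandermonde v).det := by
  rw [Matrix.det_eval_matrixOfPolynomials_eq_det_vandermonde v
    (fun j => ∏ k ∈ range j, (Polynomial.X - Polynomial.C (x k)))]
  · congr 1
    ext i j
    simp [Polynomial.eval_prod]
  · intro i
    rw [Polynomial.natDegree_finsetProd_X_sub_C_eq_card]
    simp
  · intro i
    exact Polynomial.monic_prod_of_monic _ _ fun k _ => Polynomial.monic_X_sub_C _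

theorem continuousOn_qNum (k : ℕ) (S : Set ℝ) : ContinuousOn (fun q => qNum q k) S := by
  unfold qNum
  fun_prop

theorem continuousOn_hookWeight (lam : YoungDiagram) :
    ContinuousOn (fun q => hookWeight q lam) (Set.Ici 0) := by
  unfold hookWeight
  refine ContinuousOn.mul (by fun_prop) (continuousOn_finsetProd _ fun c hc => ?_)
  refine ContinuousOn.div continuousOn_const (continuousOn_qNum _ _) fun q hq => ?_
  exact (zero_lt_one.trans_le (one_le_qNum hq (hookLength_pos hc).ne')).ne'

theorem continuousOn_qFact (n : ℕ) (S : Set ℝ) : ContinuousOn (fun q => qFact q n) S := by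
  unfold qFact
  exact continuousOn_finsetProd _ fun c _ => continuousOn_qNum _ _

/-- The Jacobi–Trudi determinant of a principal specialization is given by hook lengths. -/
theorem det_jacobiTrudi {q : ℝ} (hq : 0 ≤ q) {N : ℕ} {lam : YoungDiagram}
    (h : lam.colLen 0 ≤ N) :
    (jacobiTrudi (fun n => 1 / qFact q n) (particlePos N lam)).det = hookWeight q lam := by
  -- Powers of q must be cancelled, so q > 0 is treated first; q = 0 follows by continuity.
  have key : Set.EqOn
      (fun q => (jacobiTrudi (fun n => 1 / qFact q n) (particlePos N lam)).det)
      (fun q => hookWeight q lam) (Set.Ioi 0) := by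
    intro q hq
    have hq0 : (0 : ℝ) < q := hq
    simp only
    have h1 : (Matrix.of fun i j : Fin N => ∏ k ∈ range j,
        (qNum q (particlePos N lam i) - qNum q k)) =
        Matrix.of fun i j => qFact q (particlePos N lam i) *
          (Matrix.of fun i j : Fin N => q ^ (∑ k ∈ range (j : ℕ), k) *
            jacobiTrudi (fun n => 1 / qFact q n) (particlePos N lam) i j) i j := by
      ext i j
      simp only [Matrix.of_apply, jacobiTrudi]
      rw [← qFact_falling hq0.le]
      ring
    have h2 := det_prod_sub_eq_det_vandermonde (fun a => qNum q (particlePos N lam a)) (qNum q)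
    rw [h1, Matrix.det_mul_column, Matrix.det_mul_row,
      det_vandermonde_qNum_particlePos q hq0.le h] at h2
    have h3 : ∏ a, qFact q (particlePos N lam a) ≠ 0 :=
      Finset.prod_ne_zero_iff.2 fun a _ => (qFact_pos hq0.le _).ne'
    have h4 : ∏ a : Fin N, q ^ (∑ k ∈ range (a : ℕ), k) ≠ 0 :=
      Finset.prod_ne_zero_iff.2 fun a _ => by positivity
    refine mul_left_cancel₀ (mul_ne_zero h3 h4) ?_
    linear_combination h2
  refine key.of_subset_closure (t := Set.Ici 0) ?_ (continuousOn_hookWeight lam)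
    Set.Ioi_subset_Ici_self (by rw [closure_Ioi]) (Set.mem_Ici.2 hq)
  simp only [Matrix.det_apply]
  refine continuousOn_finsetSum _ fun σ _ => ContinuousOn.const_smul ?_ _
  refine continuousOn_finsetProd _ fun i _ => ?_
  simp only [jacobiTrudi, Matrix.of_apply]
  split_ifs
  · exact ContinuousOn.div continuousOn_const (continuousOn_qFact _ _)
      fun q hq => (qFact_pos hq _).ne'
  · exact continuousOn_const

/-! ### Cauchy–Binet and biorthogonal ensembles -/

theorem det_submatrix_comp_perm {N L : Type*} [Fintype N] [DecidableEq N]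
    (U : Matrix L N ℝ) (s : N → L) (σ : Equiv.Perm N) :
    (U.submatrix (s ∘ σ) id).det = (Equiv.Perm.sign σ : ℤ) * (U.submatrix s id).det := by
  have := Matrix.det_permute σ (U.submatrix s id)
  rw [Matrix.submatrix_submatrix] at this
  simpa using this

/-- The Cauchy–Binet formula, summed over tuples. -/
theorem factorial_mul_det_mul {n m : Type*} [Fintype n] [DecidableEq n] [Fintype m]
    [DecidableEq m] (V : Matrix n m ℝ) (U : Matrix m n ℝ) :
    ((Fintype.card n).factorial : ℝ) * (V * U).det =
      ∑ s : n → m, (V.submatrix id s).det * (U.submatrix s id).det := by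
  have h1 : (V * U).det = ∑ s : n → m, (∏ i, V i (s i)) * (U.submatrix s id).det := by
    have e : (V * U) = fun i => ∑ l, V i l • U l := by
      ext i j
      simp [Matrix.mul_apply, Finset.sum_apply]
    have := (Matrix.detRowAlternating (n := n) (R := ℝ)).toMultilinearMap.map_sum
      (fun i l => V i l • U l)
    rw [e]
    refine this.trans (Finset.sum_congr rfl fun s _ => ?_)
    exact ((Matrix.detRowAlternating (n := n) (R := ℝ)).toMultilinearMap.map_smul_univ
      (fun i => V i (s i)) (fun i => U (s i)))
  -- Composing the tuples with σ brings a sign from the minor of U, which cancels the explicit one.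
  -- Summing over σ then assembles the products of entries of V into minors, at the price of the
  -- factorial.
  have h2 : ∀ σ : Equiv.Perm n,
      ∑ s : n → m, ((Equiv.Perm.sign σ : ℤ) : ℝ) * (∏ i, V (σ i) (s i)) *
        (U.submatrix s id).det = (V * U).det := by
    intro σ
    rw [h1, ← (Equiv.arrowCongr σ (Equiv.refl m)).symm.sum_comp]
    refine Finset.sum_congr rfl fun s _ => ?_
    have e1 : (Equiv.arrowCongr σ (Equiv.refl m)).symm s = s ∘ σ := by
      ext i
      simp [Equiv.arrowCongr]
    rw [e1]
    rw [det_submatrix_comp_perm]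
    have e3 : ∏ i, V (σ i) ((s ∘ σ) i) = ∏ i, V i (s i) :=
      Equiv.prod_comp σ (fun i => V i (s i))
    rw [e3]
    have e4 : ((Equiv.Perm.sign σ : ℤ) : ℝ) * ((Equiv.Perm.sign σ : ℤ) : ℝ) = 1 := by
      rw [← Int.cast_mul, Int.units_coe_mul_self, Int.cast_one]
    linear_combination (∏ i, V i (s i)) * (U.submatrix s id).det * e4
  calc ((Fintype.card n).factorial : ℝ) * (V * U).det
      = ∑ σ : Equiv.Perm n, (V * U).det := by
        simp [Finset.card_univ, Fintype.card_perm]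
    _ = ∑ σ : Equiv.Perm n, ∑ s : n → m, ((Equiv.Perm.sign σ : ℤ) : ℝ) * (∏ i, V (σ i) (s i)) *
        (U.submatrix s id).det := Finset.sum_congr rfl fun σ _ => (h2 σ).symm
    _ = _ := by
        rw [Finset.sum_comm]
        refine Finset.sum_congr rfl fun s _ => ?_
        rw [Matrix.det_apply' (V.submatrix id s), Finset.sum_mul]
        rfl

theorem det_submatrix_eq_zero_of_not_injective {n m : Type*} [Fintype n] [DecidableEq n]
    (U : Matrix m n ℝ) {s : n → m} (h : ¬ Function.Injective s) :
    (U.submatrix s id).det = 0 := by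
  simp only [Function.Injective, not_forall] at h
  obtain ⟨a, b, hab, hne⟩ := h
  exact Matrix.det_zero_of_row_eq hne (by ext j; simp [hab])

theorem factorial_mul_det_mul_diagonal {n m : Type*} [Fintype n] [DecidableEq n] [Fintype m]
    [DecidableEq m] (V : Matrix n m ℝ) (U : Matrix m n ℝ) (w : m → ℝ) :
    ((Fintype.card n).factorial : ℝ) * (V * Matrix.diagonal w * U).det =
      ∑ s : n → m, (∏ i, w (s i)) * ((V.submatrix id s).det * (U.submatrix s id).det) := by
  rw [factorial_mul_det_mul]
  refine Finset.sum_congr rfl fun s _ => ?_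
  have : (V * Matrix.diagonal w).submatrix id s =
      Matrix.of fun i j => w (s j) * V.submatrix id s i j := by
    ext i j
    simp [Matrix.mul_diagonal, mul_comm]
  rw [this, Matrix.det_mul_row]
  ring

/-- Biorthogonal ensembles are determinantal. -/
theorem sum_subset_range_eq_det {n m : Type*} [Fintype n] [DecidableEq n] [Fintype m]
    [DecidableEq m] (V : Matrix n m ℝ) (U : Matrix m n ℝ) (hG : (V * U).det ≠ 0)
    {k : ℕ} (z : Fin k → m) (hz : Function.Injective z) :
    ∑ s : n → m, (open scoped Classical in if Set.range z ⊆ Set.range s then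
        (V.submatrix id s).det * (U.submatrix s id).det else 0) =
      ((Fintype.card n).factorial : ℝ) * (V * U).det *
        ((U * (V * U)⁻¹ * V).submatrix z z).det := by
  classical
  set K := (U * (V * U)⁻¹ * V).submatrix z z with hK
  set Z : Finset m := univ.image z with hZ
  have hZcard : Z.card = k := by
    rw [hZ, Finset.card_image_of_injective _ hz, Finset.card_univ, Fintype.card_fin]
  let c : (n → m) → ℕ := fun s => (univ.filter fun i => s i ∈ Z).card
  -- For injective s the weight is ε^k ∏ (1 + 1[s i ∈ Z]/ε), a polynomial in ε which at ε = 0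
  -- selects the tuples that cover Z. Other tuples have vanishing minors, so the truncated exponent
  -- k - c s is harmless.
  let f : ℝ → ℝ := fun ε => ∑ s : n → m, ε ^ (k - c s) * (1 + ε) ^ c s *
    ((V.submatrix id s).det * (U.submatrix s id).det)
  let g : ℝ → ℝ := fun ε => ((Fintype.card n).factorial : ℝ) * (V * U).det *
    (Matrix.of fun i j => (if i = j then ε else 0) + K i j).det
  have hcle : ∀ s : n → m, Function.Injective s → c s ≤ k := by
    intro s hs
    rw [← hZcard]
    exact Finset.card_le_card_of_injOn s (by intro i hi; simpa using hi) hs.injOn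
  have hfg : f = g := by
    refine Continuous.ext_on (dense_compl_singleton (0 : ℝ)) ?_ ?_ ?_
    · fun_prop
    · refine Continuous.mul continuous_const (Continuous.matrix_det ?_)
      refine continuous_matrix fun i j => ?_
      simp only [Matrix.of_apply]
      split_ifs <;> fun_prop
    · intro ε hε
      have hε0 : ε ≠ 0 := hε
      simp only [f, g]
      have e1 := factorial_mul_det_mul_diagonal V U (fun l => 1 + if l ∈ Z then ε⁻¹ else 0)
      have e2 : V * Matrix.diagonal (fun l => 1 + if l ∈ Z then ε⁻¹ else 0) * U =
          V * U + (ε⁻¹ • V.submatrix id z) * U.submatrix z id := by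
        ext i j
        rw [Matrix.mul_apply, Matrix.add_apply, Matrix.mul_apply, Matrix.mul_apply]
        simp only [Matrix.mul_diagonal, Matrix.smul_apply, Matrix.submatrix_apply, id_eq,
          smul_eq_mul]
        have : ∑ x, ε⁻¹ * V i (z x) * U (z x) j = ∑ l ∈ Z, ε⁻¹ * V i l * U l j := by
          rw [hZ, Finset.sum_image hz.injOn]
        rw [this, ← Finset.sum_filter_add_sum_filter_not univ (fun l => l ∈ Z)]
        rw [← Finset.sum_filter_add_sum_filter_not univ (fun l => l ∈ Z) (fun l => V i l * U l j)]
        have e3 : Finset.filter (fun l => l ∈ Z) univ = Z := by ext; simp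
        rw [e3, add_right_comm, ← Finset.sum_add_distrib]
        congr 1
        · refine Finset.sum_congr rfl fun l hl => ?_
          rw [if_pos hl]
          ring
        · refine Finset.sum_congr rfl fun l hl => ?_
          rw [if_neg (Finset.mem_filter.1 hl).2]
          ring
      -- The matrix determinant lemma reduces the perturbed n × n determinant to a k × k determinant
      -- in the kernel.
      rw [e2, Matrix.det_add_mul _ _ hG.isUnit] at e1
      have e4 : (Matrix.of fun i j => (if i = j then ε else 0) + K i j) =
          ε • (1 + U.submatrix z id * (V * U)⁻¹ * (ε⁻¹ • V.submatrix id z)) := by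
        ext i j
        have : K i j = (U.submatrix z id * (V * U)⁻¹ * V.submatrix id z) i j := by
          simp [hK, Matrix.mul_apply]
        simp only [Matrix.of_apply, this, Matrix.mul_smul, Matrix.smul_apply, Matrix.add_apply,
          smul_eq_mul, Matrix.one_apply, mul_add, mul_ite, mul_one, mul_zero]
        rw [mul_inv_cancel_left₀ hε0]
      rw [e4, Matrix.det_smul, Fintype.card_fin]
      have e5 : ∀ s : n → m, ε ^ (k - c s) * (1 + ε) ^ c s *
          ((V.submatrix id s).det * (U.submatrix s id).det) =
          ε ^ k * ((∏ i, (1 + if s i ∈ Z then ε⁻¹ else 0)) *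
            ((V.submatrix id s).det * (U.submatrix s id).det)) := by
        intro s
        by_cases hs : Function.Injective s
        · have e6 : ∏ i, (1 + if s i ∈ Z then ε⁻¹ else 0) = (1 + ε⁻¹) ^ c s := by
            rw [← Finset.prod_const, Finset.prod_filter]
            refine Finset.prod_congr rfl fun i _ => ?_
            split_ifs <;> simp
          have e7 : ε ^ k = ε ^ (k - c s) * ε ^ c s := by
            rw [← pow_add, Nat.sub_add_cancel (hcle s hs)]
          have e8 : (1 + ε) = ε * (1 + ε⁻¹) := by rw [mul_add, mul_inv_cancel₀ hε0]; ring
          rw [e6, e7, e8, mul_pow]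
          ring
        · rw [det_submatrix_eq_zero_of_not_injective U hs]
          ring
      simp only [e5, ← Finset.mul_sum, ← e1]
      ring
  have h0 := congrFun hfg 0
  simp only [f, g] at h0
  have e9 : (Matrix.of fun i j => (if i = j then (0 : ℝ) else 0) + K i j) = K := by
    ext i j
    simp
  rw [e9] at h0
  rw [← h0]
  refine Finset.sum_congr rfl fun s _ => ?_
  by_cases hs : Function.Injective s
  · have hc := hcle s hs
    have himg : (univ.filter fun i => s i ∈ Z).image s = Z.filter fun l => l ∈ Set.range s := by
      ext l
      simp only [mem_image, mem_filter, mem_univ, true_and, Set.mem_range]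
      constructor
      · rintro ⟨i, hi, rfl⟩
        exact ⟨hi, i, rfl⟩
      · rintro ⟨hl, i, rfl⟩
        exact ⟨i, hl, rfl⟩
    have hcc : c s = (Z.filter fun l => l ∈ Set.range s).card := by
      rw [← himg, Finset.card_image_of_injective _ hs]
    have hiff : Set.range z ⊆ Set.range s ↔ c s = k := by
      have hcard : c s = k ↔ (Z.filter fun l => l ∈ Set.range s).card = Z.card := by
        rw [hcc, hZcard]
      rw [hcard, Finset.card_filter_eq_iff]
      simp only [hZ, Set.range_subset_iff]
      simp
    rw [if_congr hiff rfl rfl]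
    split_ifs with h
    · rw [h]
      simp
    · rw [zero_pow (by omega)]
      simp
  · rw [det_submatrix_eq_zero_of_not_injective U hs]
    simp

/-- The entries of the correlation kernel of a biorthogonal ensemble are bounded by the mean of the
partition functions of the two symmetric ensembles. -/
theorem abs_kernel_mul_det_le {n m : Type*} [Fintype n] [DecidableEq n] [Fintype m]
    [DecidableEq m] (V : Matrix n m ℝ) (U : Matrix m n ℝ) (hG : 0 < (V * U).det) (a b : m) :
    ((Fintype.card n).factorial : ℝ) * (V * U).det * |(U * (V * U)⁻¹ * V) a b| ≤
      (∑ s : n → m, (V.submatrix id s).det ^ 2 + ∑ s : n → m, (U.submatrix s id).det ^ 2) / 2 := by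
  -- Adding row a to row b of U perturbs V U by a rank-one matrix, so that det (V U') / det (V U) =
  -- 1 + K(a, b).
  set U' := U.updateRow b (U b + U a) with hU'
  have e1 : V * U' = V * U + Matrix.replicateCol Unit (fun i => V i b) *
      Matrix.replicateRow Unit (U a) := by
    ext i j
    simp only [Matrix.mul_apply, Matrix.add_apply, Matrix.replicateCol_apply,
      Matrix.replicateRow_apply, Finset.univ_unique, Finset.sum_const, Finset.card_singleton,
      one_smul]
    have : ∀ l, V i l * U' l j = V i l * U l j + if l = b then V i b * U a j else 0 := by
      intro l
      by_cases hl : l = b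
      · subst hl
        simp [hU', mul_add]
      · simp [hU', hl]
    simp [this, Finset.sum_add_distrib]
  have e2 : (V * U').det = (V * U).det * (1 + (U * (V * U)⁻¹ * V) a b) := by
    rw [e1, Matrix.det_add_mul _ _ hG.ne'.isUnit]
    congr 1
    rw [Matrix.det_unique]
    simp [Matrix.mul_apply]
  have e3 : ((Fintype.card n).factorial : ℝ) * (V * U).det * (U * (V * U)⁻¹ * V) a b =
      ∑ s : n → m, (V.submatrix id s).det *
        ((U'.submatrix s id).det - (U.submatrix s id).det) := by
    simp only [mul_sub, Finset.sum_sub_distrib]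
    rw [← factorial_mul_det_mul, ← factorial_mul_det_mul, e2]
    ring
  -- By linearity in row b, the difference of minors is the minor with row b replaced by row a: zero
  -- if s misses b or already uses a elsewhere, otherwise the minor at the swapped tuple. Swapping
  -- permutes the tuples, so it preserves the sum of squares.
  have e4 : ∀ s : n → m, Function.Injective s →
      |(U'.submatrix s id).det - (U.submatrix s id).det| ≤
        |(U.submatrix (Equiv.swap a b ∘ s) id).det| := by
    intro s hs
    by_cases hb : ∃ i, s i = b
    · obtain ⟨i, hi⟩ := hb
      have f1 : U'.submatrix s id = (U.submatrix s id).updateRow i (U b + U a) := by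
        ext x y
        by_cases hx : x = i
        · subst hx
          simp [hU', hi]
        · have : s x ≠ b := fun h => hx (hs (h.trans hi.symm))
          simp [hU', hx, this]
      have f2 : (U.submatrix s id).updateRow i (U b) = U.submatrix s id := by
        ext x y
        by_cases hx : x = i
        · subst hx
          simp [hi]
        · simp [hx]
      rw [f1, Matrix.det_updateRow_add, f2, add_sub_cancel_left]
      by_cases ha : ∃ i', i' ≠ i ∧ s i' = a
      · obtain ⟨i', hne, hi'⟩ := ha
        rw [Matrix.det_zero_of_row_eq hne]
        · simp
        · ext y
          simp [hne, hi']
      · push Not at ha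
        have f3 : (U.submatrix s id).updateRow i (U a) =
            U.submatrix (Equiv.swap a b ∘ s) id := by
          ext x y
          by_cases hx : x = i
          · subst hx
            simp [hi]
          · have h1 : s x ≠ b := fun h => hx (hs (h.trans hi.symm))
            have h2 : s x ≠ a := ha x hx
            simp [hx, Equiv.swap_apply_of_ne_of_ne h2 h1]
        rw [f3]
    · push Not at hb
      have : U'.submatrix s id = U.submatrix s id := by
        ext x y
        simp [hU', hb x]
      rw [this, sub_self, abs_zero]
      exact abs_nonneg _
  have e5 : ∑ s : n → m, (U.submatrix (Equiv.swap a b ∘ s) id).det ^ 2 =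
      ∑ s : n → m, (U.submatrix s id).det ^ 2 :=
    (Equiv.arrowCongr (Equiv.refl n) (Equiv.swap a b)).sum_comp
      (fun s => (U.submatrix s id).det ^ 2)
  have hpos : 0 ≤ ((Fintype.card n).factorial : ℝ) * (V * U).det := by positivity
  rw [← abs_of_nonneg hpos, ← abs_mul, e3, ← e5, ← Finset.sum_add_distrib, Finset.sum_div]
  refine (Finset.abs_sum_le_sum_abs _ _).trans (Finset.sum_le_sum fun s _ => ?_)
  by_cases hs : Function.Injective s
  · rw [abs_mul]
    have h1 := e4 s hs
    have h2 := two_mul_le_add_sq |(V.submatrix id s).det| |(U.submatrix (Equiv.swap a b ∘ s) id).det|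
    rw [sq_abs, sq_abs] at h2
    have h3 := mul_le_mul_of_nonneg_left h1 (abs_nonneg (V.submatrix id s).det)
    linarith
  · have : (V.submatrix id s).det = 0 := by
      have := det_submatrix_eq_zero_of_not_injective V.transpose hs
      rwa [← Matrix.det_transpose, Matrix.transpose_submatrix, Matrix.transpose_transpose] at this
    rw [this]
    simp only [zero_mul, abs_zero]
    positivity

/-! ### Schur measures in a box and the limit kernel -/

/-- The Schur function of `lam` at the principal specialization with parameters `x`, `q`. -/
def schurWeight (x q : ℝ) (lam : YoungDiagram) : ℝ := x ^ lam.card * hookWeight q lam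

theorem schurWeight_nonneg {x q : ℝ} (hx : 0 ≤ x) (hq : 0 ≤ q) (lam : YoungDiagram) :
    0 ≤ schurWeight x q lam :=
  mul_nonneg (by positivity) (hookWeight_nonneg hq lam)

theorem colLen_bot (i : ℕ) : (⊥ : YoungDiagram).colLen i = 0 := by
  by_contra h
  exact YoungDiagram.notMem_bot (0, i) (YoungDiagram.mem_iff_lt_colLen.2 (Nat.pos_of_ne_zero h))

theorem hookWeight_bot (q : ℝ) : hookWeight q ⊥ = 1 := by
  simp [hookWeight, bStat, colLen_bot]

theorem schurWeight_bot (x q : ℝ) : schurWeight x q ⊥ = 1 := by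
  simp [schurWeight, hookWeight_bot, YoungDiagram.card]

/-- The complete homogeneous symmetric functions of the principal specialization. -/
def completeHomog (x q : ℝ) (n : ℕ) : ℝ := x ^ n * (1 / qFact q n)

theorem det_jacobiTrudi_completeHomog (x : ℝ) {q : ℝ} (hq : 0 ≤ q) {N : ℕ} {lam : YoungDiagram}
    (h : lam.colLen 0 ≤ N) :
    (jacobiTrudi (completeHomog x q) (particlePos N lam)).det = schurWeight x q lam := by
  -- Homogeneity: scaling rows by x^(l_i) and columns by x^j leaves the factor x^|λ|. The case x = 0
  -- follows by continuity.
  have key : (fun x => (jacobiTrudi (completeHomog x q) (particlePos N lam)).det) =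
      fun x => schurWeight x q lam := by
    refine Continuous.ext_on (dense_compl_singleton (0 : ℝ)) ?_ ?_ ?_
    · refine Continuous.matrix_det (continuous_matrix fun i j => ?_)
      simp only [jacobiTrudi, Matrix.of_apply, completeHomog]
      split_ifs <;> fun_prop
    · unfold schurWeight
      fun_prop
    · intro x hx
      have hx0 : x ≠ 0 := hx
      simp only
      have e : (Matrix.of fun i j : Fin N => x ^ (j : ℕ) *
          jacobiTrudi (completeHomog x q) (particlePos N lam) i j) =
          Matrix.of fun i j : Fin N => x ^ particlePos N lam i *
            jacobiTrudi (fun n => 1 / qFact q n) (particlePos N lam) i j := by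
        ext i j
        simp only [Matrix.of_apply, jacobiTrudi, completeHomog]
        split_ifs with hij
        · rw [← mul_assoc, ← pow_add, Nat.add_sub_cancel' hij]
        · simp
      have e2 := congrArg Matrix.det e
      rw [Matrix.det_mul_row, Matrix.det_mul_column, det_jacobiTrudi hq h,
        Finset.prod_pow_eq_pow_sum, Finset.prod_pow_eq_pow_sum, ← card_add_sum_eq h, pow_add] at e2
      have hne : x ^ (∑ a : Fin N, (a : ℕ)) ≠ 0 := by positivity
      refine mul_left_cancel₀ hne ?_
      rw [e2, schurWeight]
      ring
  exact congrFun key x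

theorem det_comp_perm_mul {N : ℕ} (A B : Matrix ℕ (Fin N) ℝ) (s : Fin N → ℕ) (σ : Equiv.Perm (Fin N)) :
    (A.submatrix (s ∘ σ) id).det * (B.submatrix (s ∘ σ) id).det =
      (A.submatrix s id).det * (B.submatrix s id).det := by
  rw [det_submatrix_comp_perm, det_submatrix_comp_perm]
  have e4 : ((Equiv.Perm.sign σ : ℤ) : ℝ) * ((Equiv.Perm.sign σ : ℤ) : ℝ) = 1 := by
    rw [← Int.cast_mul, Int.units_coe_mul_self, Int.cast_one]
  linear_combination (A.submatrix s id).det * (B.submatrix s id).det * e4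

/-- The sum over tuples of a product of two minors and an invariant function, as a sum over
partitions. -/
theorem sum_det_mul_det {N L : ℕ} (hNL : N ≤ L) (A B : Matrix ℕ (Fin N) ℝ) (P : Set ℕ → ℝ) :
    ∑ s : Fin N → Fin L, P (Set.range fun i => (s i : ℕ)) *
      ((A.submatrix (fun i => (s i : ℕ)) id).det * (B.submatrix (fun i => (s i : ℕ)) id).det) =
      (N.factorial : ℝ) * ∑ lam ∈ partitionBox N L, P (Set.range (particlePos N lam)) *
        ((A.submatrix (particlePos N lam) id).det * (B.submatrix (particlePos N lam) id).det) := by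
  refine sum_tuples_eq_sum_partitionBox hNL
    (fun s => P (Set.range s) * ((A.submatrix s id).det * (B.submatrix s id).det)) ?_ ?_
  · intro s σ
    rw [det_comp_perm_mul, σ.surjective.range_comp]
  · intro s hs
    rw [det_submatrix_eq_zero_of_not_injective A hs]
    simp

/-- The position corresponding to a half-integer. -/
def positionOf (N : ℕ) (z : HalfInt) : ℕ := (z.2.choose + N).toNat

theorem siteOf_positionOf {N : ℕ} {z : HalfInt} (h : 0 ≤ z.2.choose + N) :
    siteOf N (positionOf N z) = z := by
  apply Subtype.ext
  rw [z.2.choose_spec]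
  simp only [siteOf, positionOf, Int.toNat_of_nonneg h]
  simp

/-- The empty partition alone contributes 1. Hence the box determinant is invertible and can be
dropped from the kernel bound. -/
theorem one_le_sum_partitionBox {x q y p : ℝ} (hx : 0 ≤ x) (hq : 0 ≤ q) (hy : 0 ≤ y) (hp : 0 ≤ p)
    {N L : ℕ} (hNL : N ≤ L) :
    1 ≤ ∑ lam ∈ partitionBox N L, schurWeight x q lam * schurWeight y p lam := by
  have hbot : ⊥ ∈ partitionBox N L := by
    rw [mem_partitionBox, colLen_bot, YoungDiagram.rowLen_eq_zero_of_colLen_le (colLen_bot 0).le]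
    omega
  have := Finset.single_le_sum (f := fun lam => schurWeight x q lam * schurWeight y p lam)
    (fun lam _ => mul_nonneg (schurWeight_nonneg hx hq lam) (schurWeight_nonneg hy hp lam)) hbot
  simpa [schurWeight_bot] using this

/-- A Schur measure restricted to a box is determinantal, with a bounded kernel. -/
theorem exists_kernel_partitionBox {x q y p : ℝ} (hx : 0 ≤ x) (hq : 0 ≤ q) (hy : 0 ≤ y)
    (hp : 0 ≤ p) {N L : ℕ} (hNL : N ≤ L) :
    ∃ K : HalfInt → HalfInt → ℝ,
      (∀ a b, |K a b| ≤ (∑ lam ∈ partitionBox N L, schurWeight x q lam ^ 2 +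
        ∑ lam ∈ partitionBox N L, schurWeight y p lam ^ 2) / 2) ∧
      ∀ (k : ℕ) (z : Fin k ↪ HalfInt),
        (∀ i, 0 ≤ (z i).2.choose + N ∧ positionOf N (z i) < L) →
        ∑ lam ∈ partitionBox N L, (open scoped Classical in
          if Set.range z ⊆ configuration lam then schurWeight x q lam * schurWeight y p lam
            else 0) =
        (∑ lam ∈ partitionBox N L, schurWeight x q lam * schurWeight y p lam) *
          (Matrix.of fun i j => K (z i) (z j)).det := by
  classical
  let A : Matrix ℕ (Fin N) ℝ :=
    Matrix.of fun l j => if (j : ℕ) ≤ l then completeHomog x q (l - j) else 0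
  let B : Matrix ℕ (Fin N) ℝ :=
    Matrix.of fun l j => if (j : ℕ) ≤ l then completeHomog y p (l - j) else 0
  have hA : ∀ lam ∈ partitionBox N L,
      (A.submatrix (particlePos N lam) id).det = schurWeight x q lam :=
    fun lam h => det_jacobiTrudi_completeHomog x hq (mem_partitionBox.1 h).1
  have hB : ∀ lam ∈ partitionBox N L,
      (B.submatrix (particlePos N lam) id).det = schurWeight y p lam :=
    fun lam h => det_jacobiTrudi_completeHomog y hp (mem_partitionBox.1 h).1
  let U : Matrix (Fin L) (Fin N) ℝ := A.submatrix Fin.val id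
  let V : Matrix (Fin N) (Fin L) ℝ := (B.submatrix Fin.val id).transpose
  have hU : ∀ s : Fin N → Fin L,
      (U.submatrix s id).det = (A.submatrix (fun i => (s i : ℕ)) id).det := fun s => rfl
  have hV : ∀ s : Fin N → Fin L,
      (V.submatrix id s).det = (B.submatrix (fun i => (s i : ℕ)) id).det := by
    intro s
    rw [← Matrix.det_transpose]
    rfl
  have hfac : (0 : ℝ) < N.factorial := by positivity
  set S := ∑ lam ∈ partitionBox N L, schurWeight x q lam * schurWeight y p lam with hS
  have hS1 : 1 ≤ S := one_le_sum_partitionBox hx hq hy hp hNL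
  have hdet : (V * U).det = S := by
    have h1 := factorial_mul_det_mul V U
    rw [Fintype.card_fin] at h1
    have h2 := sum_det_mul_det hNL B A (fun _ => 1)
    simp only [one_mul] at h2
    simp only [hU, hV] at h1
    rw [h2] at h1
    rw [mul_left_cancel₀ hfac.ne' h1, hS]
    refine Finset.sum_congr rfl fun lam hlam => ?_
    rw [hA lam hlam, hB lam hlam, mul_comm]
  have hsqA : ∑ s : Fin N → Fin L, (U.submatrix s id).det ^ 2 =
      N.factorial * ∑ lam ∈ partitionBox N L, schurWeight x q lam ^ 2 := by
    have h2 := sum_det_mul_det hNL A A (fun _ => 1)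
    simp only [one_mul, ← pow_two] at h2
    simp only [hU]
    rw [h2]
    congr 1
    exact Finset.sum_congr rfl fun lam hlam => by rw [hA lam hlam]
  have hsqB : ∑ s : Fin N → Fin L, (V.submatrix id s).det ^ 2 =
      N.factorial * ∑ lam ∈ partitionBox N L, schurWeight y p lam ^ 2 := by
    have h2 := sum_det_mul_det hNL B B (fun _ => 1)
    simp only [one_mul, ← pow_two] at h2
    simp only [hV]
    rw [h2]
    congr 1
    exact Finset.sum_congr rfl fun lam hlam => by rw [hB lam hlam]
  have hpos : 0 < (V * U).det := by linarith
  -- `toNat` sends sites left of the box to position 0. The bound survives this, and the determinant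
  -- formula is only claimed for sites inside the box.
  refine ⟨fun a b => if h : positionOf N a < L ∧ positionOf N b < L then
    (U * (V * U)⁻¹ * V) ⟨positionOf N a, h.1⟩ ⟨positionOf N b, h.2⟩ else 0, ?_, ?_⟩
  · intro a b
    beta_reduce
    split_ifs with h
    · have h1 := abs_kernel_mul_det_le V U hpos ⟨positionOf N a, h.1⟩ ⟨positionOf N b, h.2⟩
      rw [hsqA, hsqB, Fintype.card_fin, mul_assoc, ← mul_add, mul_div_assoc] at h1
      have h2 := le_of_mul_le_mul_left h1 hfac
      rw [hdet] at h2
      have h3 := mul_le_mul_of_nonneg_right hS1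
        (abs_nonneg ((U * (V * U)⁻¹ * V) ⟨positionOf N a, h.1⟩ ⟨positionOf N b, h.2⟩))
      linarith
    · rw [abs_zero]
      positivity
  · intro k z hz
    let w : Fin k → Fin L := fun i => ⟨positionOf N (z i), (hz i).2⟩
    have hsite : ∀ i, siteOf N (w i) = z i := fun i => siteOf_positionOf (hz i).1
    have hw : Function.Injective w := by
      intro i j hij
      apply z.injective
      rw [← hsite i, ← hsite j, hij]
    have h1 := sum_subset_range_eq_det V U hpos.ne' w hw
    rw [Fintype.card_fin, hdet] at h1
    have h2 := sum_det_mul_det hNL B A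
      (fun T => if Set.range (fun i => (w i : ℕ)) ⊆ T then 1 else 0)
    have h3 : ∀ s : Fin N → Fin L, (Set.range w ⊆ Set.range s ↔
        Set.range (fun i => (w i : ℕ)) ⊆ Set.range (fun i => (s i : ℕ))) := by
      intro s
      simp only [Set.range_subset_iff, Set.mem_range, Fin.ext_iff]
    have h4 : ∀ lam ∈ partitionBox N L, (Set.range z ⊆ configuration lam ↔
        Set.range (fun i => (w i : ℕ)) ⊆ Set.range (particlePos N lam)) := by
      intro lam hlam
      simp only [Set.range_subset_iff]
      refine forall_congr' fun i => ?_
      rw [← hsite i, siteOf_mem_configuration (mem_partitionBox.1 hlam).1]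
    have h5 : ∑ lam ∈ partitionBox N L, (if Set.range z ⊆ configuration lam then
        schurWeight x q lam * schurWeight y p lam else 0) =
        ∑ lam ∈ partitionBox N L,
          (if Set.range (fun i => (w i : ℕ)) ⊆ Set.range (particlePos N lam) then 1 else 0) *
          ((B.submatrix (particlePos N lam) id).det *
            (A.submatrix (particlePos N lam) id).det) := by
      refine Finset.sum_congr rfl fun lam hlam => ?_
      rw [hA lam hlam, hB lam hlam, if_congr (h4 lam hlam) rfl rfl, ite_mul, one_mul, zero_mul,
        mul_comm (schurWeight x q lam)]
    have h6 : ∑ s : Fin N → Fin L, (if Set.range w ⊆ Set.range s then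
        (V.submatrix id s).det * (U.submatrix s id).det else 0) =
        ∑ s : Fin N → Fin L,
          (if Set.range (fun i => (w i : ℕ)) ⊆ Set.range (fun i => (s i : ℕ)) then 1 else 0) *
          ((B.submatrix (fun i => (s i : ℕ)) id).det *
            (A.submatrix (fun i => (s i : ℕ)) id).det) := by
      refine Finset.sum_congr rfl fun s _ => ?_
      rw [hU, hV, if_congr (h3 s) rfl rfl, ite_mul, one_mul, zero_mul]
    rw [h5]
    refine mul_left_cancel₀ hfac.ne' ?_
    rw [← h2, ← h6, h1, ← mul_assoc]
    congr 2
    ext i j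
    simp only [Matrix.of_apply, Matrix.submatrix_apply]
    rw [dif_pos ⟨(hz i).2, (hz j).2⟩]

theorem tendsto_partitionBox_atTop :
    Tendsto (fun n : ℕ => partitionBox n (2 * n)) atTop atTop := by
  refine tendsto_atTop_finset_of_monotone ?_ ?_
  · intro m n hmn lam hlam
    rw [mem_partitionBox] at hlam ⊢
    omega
  · intro lam
    refine ⟨lam.colLen 0 + lam.rowLen 0, ?_⟩
    rw [mem_partitionBox]
    omega

/-- The point configuration of a Schur measure with principal specializations is determinantal. -/
theorem exists_kernel_schurWeight {x q y p Z : ℝ} (hx : 0 ≤ x) (hq : 0 ≤ q) (hy : 0 ≤ y)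
    (hp : 0 ≤ p) (hsum : HasSum (fun lam => schurWeight x q lam * schurWeight y p lam) Z)
    (hxq : Summable fun lam => schurWeight x q lam ^ 2)
    (hyp : Summable fun lam => schurWeight y p lam ^ 2) :
    ∃ K : HalfInt → HalfInt → ℝ, ∀ (k : ℕ) (z : Fin k ↪ HalfInt),
      HasSum (fun lam => open scoped Classical in if Set.range z ⊆ configuration lam then
        schurWeight x q lam * schurWeight y p lam else 0)
        (Z * (Matrix.of fun i j => K (z i) (z j)).det) := by
  classical
  have hnn : ∀ lam, 0 ≤ schurWeight x q lam * schurWeight y p lam := fun lam =>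
    mul_nonneg (schurWeight_nonneg hx hq lam) (schurWeight_nonneg hy hp lam)
  choose K hKb hK using fun n : ℕ =>
    exists_kernel_partitionBox hx hq hy hp (show n ≤ 2 * n by omega)
  set C := (∑' lam, schurWeight x q lam ^ 2 + ∑' lam, schurWeight y p lam ^ 2) / 2
  have hKC : ∀ n a b, K n a b ∈ Set.Icc (-C) C := by
    intro n a b
    rw [Set.mem_Icc, ← abs_le]
    refine (hKb n a b).trans ?_
    have h1 := hxq.sum_le_tsum (partitionBox n (2 * n)) (fun lam _ => sq_nonneg _)
    have h2 := hyp.sum_le_tsum (partitionBox n (2 * n)) (fun lam _ => sq_nonneg _)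
    simp only [C]
    linarith
  -- One nonprincipal ultrafilter makes all entries converge simultaneously, by compactness of [-C,
  -- C]; no diagonal extraction is needed.
  have hlim : ∀ a b, ∃ c, Tendsto (fun n => K n a b) (hyperfilter ℕ : Filter ℕ) (𝓝 c) := by
    intro a b
    obtain ⟨c, -, hc⟩ := (isCompact_Icc (a := -C) (b := C)).ultrafilter_le_nhds
      ((hyperfilter ℕ).map fun n => K n a b)
      (le_principal_iff.2 (Filter.mem_map.2 (Filter.Eventually.of_forall fun n => hKC n a b)))
    exact ⟨c, hc⟩
  choose K' hK' using hlim
  have hle : (hyperfilter ℕ : Filter ℕ) ≤ atTop := by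
    rw [← Nat.cofinite_eq_atTop]
    exact hyperfilter_le_cofinite
  refine ⟨K', fun k z => ?_⟩
  have hs : Summable (fun lam => if Set.range z ⊆ configuration lam then
      schurWeight x q lam * schurWeight y p lam else 0) := by
    refine Summable.of_nonneg_of_le (fun lam => ?_) (fun lam => ?_) hsum.summable
    · split_ifs
      exacts [hnn lam, le_rfl]
    · split_ifs
      exacts [le_rfl, hnn lam]
  have h1 := (hs.hasSum.comp tendsto_partitionBox_atTop).mono_left hle
  have h2 := (hsum.comp tendsto_partitionBox_atTop).mono_left hle
  have h3 : Tendsto (fun n => (Matrix.of fun i j => K n (z i) (z j)).det)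
      (hyperfilter ℕ : Filter ℕ) (𝓝 (Matrix.of fun i j => K' (z i) (z j)).det) := by
    have hc : Continuous fun M : Matrix (Fin k) (Fin k) ℝ => M.det :=
      continuous_id.matrix_det
    refine (hc.tendsto _).comp ?_
    exact tendsto_pi_nhds.2 fun i => tendsto_pi_nhds.2 fun j => hK' (z i) (z j)
  have h4 : ∀ᶠ n : ℕ in atTop, ∀ i, 0 ≤ (z i).2.choose + n ∧ positionOf n (z i) < 2 * n := by
    refine eventually_all.2 fun i => ?_
    filter_upwards [eventually_gt_atTop ((z i).2.choose.natAbs)] with n hn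
    simp only [positionOf]
    omega
  have h5 := h2.mul h3
  have h6 : Tendsto (fun n => ∑ lam ∈ partitionBox n (2 * n),
      (if Set.range z ⊆ configuration lam then
        schurWeight x q lam * schurWeight y p lam else 0)) (hyperfilter ℕ : Filter ℕ)
      (𝓝 (Z * (Matrix.of fun i j => K' (z i) (z j)).det)) := by
    refine h5.congr' ?_
    filter_upwards [hle h4] with n hn
    exact (hK n k z hn).symm
  rw [← tendsto_nhds_unique h1 h6]
  exact hs.hasSum

/-! ### The Cauchy identity for variables in geometric progression -/

/-- The ratio between finite- and infinite-variable principal specializations. -/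
def truncationFactor (q : ℝ) (N : ℕ) (lam : YoungDiagram) : ℝ :=
  ∏ c ∈ lam.cells, (1 - q ^ (N - 1 - c.1 + c.2 + 1))

theorem truncationFactor_nonneg {q : ℝ} (h0 : 0 ≤ q) (h1 : q ≤ 1) (N : ℕ) (lam : YoungDiagram) :
    0 ≤ truncationFactor q N lam :=
  Finset.prod_nonneg fun _ _ => sub_nonneg.2 (pow_le_one₀ h0 h1)

theorem truncationFactor_le_one {q : ℝ} (h0 : 0 ≤ q) (h1 : q ≤ 1) (N : ℕ) (lam : YoungDiagram) :
    truncationFactor q N lam ≤ 1 :=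
  Finset.prod_le_one (fun _ _ => sub_nonneg.2 (pow_le_one₀ h0 h1))
    fun _ _ => sub_le_self _ (by positivity)

theorem tendsto_truncationFactor {q : ℝ} (h0 : 0 ≤ q) (h1 : q < 1) (lam : YoungDiagram) :
    Tendsto (fun N => truncationFactor q N lam) atTop (𝓝 1) := by
  have : Tendsto (fun N => truncationFactor q N lam) atTop (𝓝 (∏ c ∈ lam.cells, (1 - 0))) := by
    refine tendsto_finsetProd _ fun c _ => tendsto_const_nhds.sub ?_
    refine (tendsto_pow_atTop_nhds_zero_of_lt_one h0 h1).comp ?_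
    refine tendsto_atTop_mono (f := fun N : ℕ => N - (1 + c.1)) (fun N => by omega) ?_
    exact tendsto_sub_atTop_nat _
  simpa using this

theorem one_sub_mul_qNum (q : ℝ) (k : ℕ) : (1 - q) * qNum q k = 1 - q ^ k :=
  mul_neg_geom_sum q k

theorem particlePos_bot (N : ℕ) (a : Fin N) : particlePos N ⊥ a = a := by
  have h : (⊥ : YoungDiagram).rowLen (N - 1 - a) = 0 := by
    by_contra h
    exact YoungDiagram.notMem_bot (N - 1 - a, 0)
      (YoungDiagram.mem_iff_lt_rowLen.2 (Nat.pos_of_ne_zero h))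
  simp [particlePos, h]

/-- The q-factorial at a + rowLen exceeds the one at a by the factors [a+j+1], one for each cell,
and a + j + 1 is N plus the content of the cell. -/
theorem prod_qFact_particlePos {q : ℝ} {N : ℕ} {lam : YoungDiagram}
    (h : lam.colLen 0 ≤ N) :
    (1 - q) ^ lam.card * ∏ a, qFact q (particlePos N lam a) =
      truncationFactor q N lam * ∏ a : Fin N, qFact q a := by
  have h1 : ∀ a : Fin N, qFact q (particlePos N lam a) =
      qFact q a * ∏ j ∈ range (lam.rowLen (N - 1 - a)), qNum q (a + j + 1) := by
    intro a
    rw [particlePos, add_comm, qFact, Finset.prod_range_add, qFact]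
  have h2 : truncationFactor q N lam = ∏ a : Fin N, ∏ j ∈ range (lam.rowLen (N - 1 - a)),
      ((1 - q) * qNum q (a + j + 1)) := by
    rw [truncationFactor, prod_cells_eq h]
    refine Finset.prod_congr rfl fun a _ => Finset.prod_congr rfl fun j _ => ?_
    have : N - 1 - (N - 1 - (a : ℕ)) = a := by omega
    rw [one_sub_mul_qNum, this]
  have h3 : (1 - q) ^ lam.card =
      ∏ a : Fin N, ∏ j ∈ range (lam.rowLen (N - 1 - a)), (1 - q) := by
    rw [← prod_cells_eq h (fun _ => 1 - q), Finset.prod_const]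
  simp only [h1, h2, h3, Finset.prod_mul_distrib]
  ring

/-- The bialternant and hook-content formulas combined: the ratio of the two determinants is s_λ(1,
q, …, q^(N-1)). As q^l = 1 - (1-q)[l], the determinants in q^l and in [l] differ by a power of q - 1
that does not depend on λ. -/
theorem det_vandermonde_pow_particlePos {q : ℝ} (hq0 : 0 < q) (hq1 : q < 1) {N : ℕ}
    {lam : YoungDiagram} (h : lam.colLen 0 ≤ N) :
    (Matrix.vandermonde fun a => q ^ particlePos N lam a).det =
      (Matrix.vandermonde fun a : Fin N => q ^ (a : ℕ)).det *
        (schurWeight (1 / (1 - q)) q lam * truncationFactor q N lam) := by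
  have key : ∀ s : Fin N → ℕ, (Matrix.vandermonde fun a => q ^ s a).det =
      (∏ a : Fin N, ∏ b ∈ Finset.Iio a, (q - 1)) *
        (Matrix.vandermonde fun a => qNum q (s a)).det := by
    intro s
    rw [det_vandermonde_eq_prod_Iio, det_vandermonde_eq_prod_Iio]
    simp only [← Finset.prod_mul_distrib]
    refine Finset.prod_congr rfl fun a _ => Finset.prod_congr rfl fun b _ => ?_
    linear_combination one_sub_mul_qNum q (s a) - one_sub_mul_qNum q (s b)
  have hbot := det_vandermonde_qNum_particlePos q (N := N) (lam := ⊥) hq0.le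
    (by rw [colLen_bot]; omega)
  simp only [particlePos_bot, hookWeight_bot, one_mul] at hbot
  rw [key, key, hbot, det_vandermonde_qNum_particlePos q hq0.le h, schurWeight, one_div, inv_pow]
  have h1 := prod_qFact_particlePos (q := q) h
  have h2 : (1 - q) ^ lam.card ≠ 0 := pow_ne_zero _ (by linarith)
  field_simp
  linear_combination (∏ a : Fin N, ∏ b ∈ Finset.Iio a, (q - 1)) * hookWeight q lam * h1

/-- The Cauchy identity for `N` variables in geometric progression, summed over boxes. -/
theorem tendsto_sum_partitionBox {q p z : ℝ} (hq0 : 0 < q) (hq1 : q < 1) (hp : 0 ≤ p)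
    (hz : 0 ≤ z) (F : ℝ → ℝ)
    (hF : ∀ w, 0 ≤ w → w ≤ z → HasSum (completeHomog w p) (F w)) (N : ℕ) :
    Tendsto (fun L => ∑ lam ∈ partitionBox N L, schurWeight (1 / (1 - q)) q lam *
      truncationFactor q N lam * schurWeight z p lam) atTop
      (𝓝 (∏ i ∈ range N, F (z * q ^ i))) := by
  let A : Matrix ℕ (Fin N) ℝ := Matrix.of fun l i => (q ^ l) ^ (i : ℕ)
  let B : Matrix ℕ (Fin N) ℝ :=
    Matrix.of fun l j => if (j : ℕ) ≤ l then completeHomog z p (l - j) else 0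
  set D := (Matrix.vandermonde fun a : Fin N => q ^ (a : ℕ)).det with hD
  have hD0 : D ≠ 0 := by
    rw [hD, Matrix.det_vandermonde_ne_zero_iff]
    intro a b hab
    exact Fin.ext (pow_right_injective₀ hq0 hq1.ne hab)
  -- By Cauchy–Binet det (G L) is D times the box sum. As L → ∞ the entry (j, i) tends to q^(ij) F(z
  -- q^i), a Vandermonde matrix with scaled columns, so the determinant tends to D ∏ F(z q^i).
  let G : ℕ → Matrix (Fin N) (Fin N) ℝ := fun L =>
    Matrix.of fun j i => ∑ l ∈ range L, B l j * A l i
  have h1 : ∀ L, N ≤ L → (G L).det = D * ∑ lam ∈ partitionBox N L,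
      schurWeight (1 / (1 - q)) q lam * truncationFactor q N lam * schurWeight z p lam := by
    intro L hL
    let V : Matrix (Fin N) (Fin L) ℝ := (B.submatrix Fin.val id).transpose
    let U : Matrix (Fin L) (Fin N) ℝ := A.submatrix Fin.val id
    have e0 : G L = V * U := by
      ext j i
      simp only [G, Matrix.of_apply, Matrix.mul_apply]
      rw [Finset.sum_range]
      rfl
    have hV : ∀ s : Fin N → Fin L,
        (V.submatrix id s).det = (B.submatrix (fun i => (s i : ℕ)) id).det := by
      intro s
      rw [← Matrix.det_transpose]
      rfl
    have hU : ∀ s : Fin N → Fin L,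
        (U.submatrix s id).det = (A.submatrix (fun i => (s i : ℕ)) id).det := fun s => rfl
    have e1 := factorial_mul_det_mul V U
    have e2 := sum_det_mul_det hL B A (fun _ => 1)
    simp only [one_mul] at e2
    simp only [hV, hU, Fintype.card_fin] at e1
    rw [e2] at e1
    rw [e0, mul_left_cancel₀ (by positivity) e1, Finset.mul_sum]
    refine Finset.sum_congr rfl fun lam hlam => ?_
    have hl := (mem_partitionBox.1 hlam).1
    have e3 : (B.submatrix (particlePos N lam) id).det = schurWeight z p lam :=
      det_jacobiTrudi_completeHomog z hp hl
    have e4 : (A.submatrix (particlePos N lam) id).det = _ :=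
      det_vandermonde_pow_particlePos hq0 hq1 hl
    rw [e3, e4]
    ring
  have h2 : Tendsto (fun L => (G L).det) atTop (𝓝 (D * ∏ i ∈ range N, F (z * q ^ i))) := by
    have e5 : D * ∏ i ∈ range N, F (z * q ^ i) =
        (Matrix.of fun j i : Fin N => F (z * q ^ (i : ℕ)) *
          (Matrix.vandermonde fun a : Fin N => q ^ (a : ℕ)) j i).det := by
      rw [Matrix.det_mul_row, Finset.prod_range (fun i => F (z * q ^ i)), mul_comm]
    rw [e5]
    have hc : Continuous fun M : Matrix (Fin N) (Fin N) ℝ => M.det := continuous_id.matrix_det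
    refine (hc.tendsto _).comp ?_
    refine tendsto_pi_nhds.2 fun j => tendsto_pi_nhds.2 fun i => ?_
    simp only [G, Matrix.of_apply, Matrix.vandermonde_apply]
    have hw : z * q ^ (i : ℕ) ≤ z := mul_le_of_le_one_right hz (pow_le_one₀ hq0.le hq1.le)
    have e6 := (hF (z * q ^ (i : ℕ)) (by positivity) hw).tendsto_sum_nat
    have e7 := (e6.mul_const ((q ^ (j : ℕ)) ^ (i : ℕ))).comp (tendsto_sub_atTop_nat (j : ℕ))
    refine e7.congr' ?_
    filter_upwards [eventually_ge_atTop (j : ℕ)] with L hL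
    obtain ⟨d, rfl⟩ := Nat.exists_eq_add_of_le hL
    simp only [Function.comp, Nat.add_sub_cancel_left]
    rw [Finset.sum_range_add]
    have e8 : ∑ l ∈ range (j : ℕ), B l j * A l i = 0 := by
      refine Finset.sum_eq_zero fun l hl => ?_
      have : ¬ (j : ℕ) ≤ l := by simpa using hl
      simp [B, this]
    rw [e8, zero_add, Finset.sum_mul]
    refine Finset.sum_congr rfl fun l _ => ?_
    simp only [A, B, Matrix.of_apply, completeHomog, Nat.add_sub_cancel_left, Nat.le_add_right,
      if_true]
    rw [pow_add, mul_pow, mul_pow, pow_right_comm q l]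
    ring
  have h3 := h2.const_mul D⁻¹
  rw [inv_mul_cancel_left₀ hD0] at h3
  refine h3.congr' ?_
  filter_upwards [eventually_ge_atTop N] with L hL
  rw [h1 L hL, inv_mul_cancel_left₀ hD0]

theorem sum_le_prod_of_truncated {q p z : ℝ} (hq0 : 0 < q) (hq1 : q < 1) (hp : 0 ≤ p)
    (hz : 0 ≤ z) (F : ℝ → ℝ)
    (hF : ∀ w, 0 ≤ w → w ≤ z → HasSum (completeHomog w p) (F w)) (N : ℕ)
    (T : Finset YoungDiagram) (hT : ∀ lam ∈ T, lam.colLen 0 ≤ N) :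
    ∑ lam ∈ T, schurWeight (1 / (1 - q)) q lam *
      truncationFactor q N lam * schurWeight z p lam ≤ ∏ i ∈ range N, F (z * q ^ i) := by
  refine ge_of_tendsto (tendsto_sum_partitionBox hq0 hq1 hp hz F hF N) ?_
  filter_upwards [eventually_ge_atTop (N + ∑ lam ∈ T, lam.rowLen 0)] with L hL
  refine Finset.sum_le_sum_of_subset_of_nonneg ?_ fun lam _ _ => ?_
  · intro lam hlam
    have := Finset.single_le_sum (f := fun lam : YoungDiagram => lam.rowLen 0)
      (fun _ _ => Nat.zero_le _) hlam
    rw [mem_partitionBox]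
    exact ⟨hT lam hlam, by omega⟩
  · have : 0 < 1 - q := by linarith
    exact mul_nonneg (mul_nonneg (schurWeight_nonneg (by positivity) hq0.le _)
      (truncationFactor_nonneg hq0.le hq1.le _ _)) (schurWeight_nonneg hz hp _)

/-- The Cauchy identity for infinitely many variables in geometric progression. -/
theorem hasSum_schurWeight_mul {q p z Z : ℝ} (hq0 : 0 < q) (hq1 : q < 1) (hp : 0 ≤ p)
    (hz : 0 ≤ z) (F : ℝ → ℝ)
    (hF : ∀ w, 0 ≤ w → w ≤ z → HasSum (completeHomog w p) (F w))
    (hZ : Tendsto (fun N => ∏ i ∈ range N, F (z * q ^ i)) atTop (𝓝 Z)) :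
    HasSum (fun lam => schurWeight (1 / (1 - q)) q lam * schurWeight z p lam) Z := by
  have hpos : 0 < 1 - q := by linarith
  have hnn : ∀ lam, 0 ≤ schurWeight (1 / (1 - q)) q lam * schurWeight z p lam := fun lam =>
    mul_nonneg (schurWeight_nonneg (by positivity) hq0.le _) (schurWeight_nonneg hz hp _)
  have hle : ∀ N lam, schurWeight (1 / (1 - q)) q lam * truncationFactor q N lam *
      schurWeight z p lam ≤ schurWeight (1 / (1 - q)) q lam * schurWeight z p lam := by
    intro N lam
    rw [mul_right_comm]
    exact mul_le_of_le_one_right (hnn lam) (truncationFactor_le_one hq0.le hq1.le N lam)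
  -- On a fixed finite set the truncation factors tend to 1, which bounds partial sums by Z. The
  -- reverse bound `hZle` holds because the factors never exceed 1.
  have hub : ∀ T : Finset YoungDiagram,
      ∑ lam ∈ T, schurWeight (1 / (1 - q)) q lam * schurWeight z p lam ≤ Z := by
    intro T
    have h1 : Tendsto (fun N => ∑ lam ∈ T, schurWeight (1 / (1 - q)) q lam *
        truncationFactor q N lam * schurWeight z p lam) atTop
        (𝓝 (∑ lam ∈ T, schurWeight (1 / (1 - q)) q lam * 1 * schurWeight z p lam)) :=
      tendsto_finsetSum _ fun lam _ =>
        ((tendsto_truncationFactor hq0.le hq1 lam).const_mul _).mul_const _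
    simp only [mul_one] at h1
    refine le_of_tendsto_of_tendsto h1 hZ ?_
    filter_upwards [eventually_ge_atTop (∑ lam ∈ T, lam.colLen 0)] with N hN
    refine sum_le_prod_of_truncated hq0 hq1 hp hz F hF N T fun lam hlam => ?_
    have := Finset.single_le_sum (f := fun lam : YoungDiagram => lam.colLen 0)
      (fun _ _ => Nat.zero_le _) hlam
    exact le_trans this hN
  have hs : Summable fun lam => schurWeight (1 / (1 - q)) q lam * schurWeight z p lam :=
    summable_of_sum_le hnn hub
  have hZle : Z ≤ ∑' lam, schurWeight (1 / (1 - q)) q lam * schurWeight z p lam := by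
    refine le_of_tendsto' hZ fun N => ?_
    refine le_of_tendsto' (tendsto_sum_partitionBox hq0 hq1 hp hz F hF N) fun L => ?_
    exact (Finset.sum_le_sum fun lam _ => hle N lam).trans (hs.sum_le_tsum _ fun lam _ => hnn lam)
  have : Z = ∑' lam, schurWeight (1 / (1 - q)) q lam * schurWeight z p lam :=
    le_antisymm hZle (hs.tsum_le_of_sum_le hub)
  rw [this]
  exact hs.hasSum

/-! ### The normalizing constants: exponential and MacMahon -/

theorem qFact_one (n : ℕ) : qFact 1 n = n.factorial := by
  simp [qFact, qNum, ← Finset.prod_range_add_one_eq_factorial]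

theorem hasSum_mixed_of_pos {q z : ℝ} (hq0 : 0 < q) (hq1 : q < 1) (hz : 0 ≤ z) :
    HasSum (fun lam => schurWeight (1 / (1 - q)) q lam * schurWeight z 1 lam)
      (Real.exp (z / (1 - q))) := by
  refine hasSum_schurWeight_mul hq0 hq1 zero_le_one hz Real.exp ?_ ?_
  · intro w _ _
    have := NormedSpace.expSeries_div_hasSum_exp (𝔸 := ℝ) w
    rw [← Real.exp_eq_exp_ℝ] at this
    refine this.congr_fun fun n => ?_
    rw [completeHomog, qFact_one]
    ring
  · simp only [← Real.exp_sum, ← Finset.mul_sum]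
    refine (Real.continuous_exp.tendsto _).comp ?_
    rw [div_eq_mul_inv]
    exact ((hasSum_geometric_of_lt_one hq0.le hq1).tendsto_sum_nat).const_mul z

/-- The `q`-exponential series. -/
def qExp (q w : ℝ) : ℝ := ∑' n, completeHomog w q n

theorem completeHomog_nonneg {w q : ℝ} (hw : 0 ≤ w) (hq : 0 ≤ q) (n : ℕ) :
    0 ≤ completeHomog w q n :=
  mul_nonneg (by positivity) (one_div_nonneg.2 (qFact_pos hq n).le)

theorem completeHomog_succ {w q : ℝ} (hq : 0 ≤ q) (n : ℕ) :
    completeHomog w q (n + 1) * (1 - q ^ (n + 1)) = w * (1 - q) * completeHomog w q n := by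
  have h1 : qNum q (n + 1) ≠ 0 :=
    (zero_lt_one.trans_le (one_le_qNum hq (Nat.succ_ne_zero n))).ne'
  have h2 := (qFact_pos hq n).ne'
  rw [completeHomog, completeHomog, qFact_succ, ← one_sub_mul_qNum]
  field_simp
  ring

theorem completeHomog_mul_pow (w q r : ℝ) (n : ℕ) :
    completeHomog (w * r) q n = r ^ n * completeHomog w q n := by
  rw [completeHomog, completeHomog, mul_pow]
  ring

theorem summable_completeHomog {w q : ℝ} (hw : 0 ≤ w) (hq0 : 0 ≤ q) (hq1 : q < 1)
    (hwq : w * (1 - q) < 1) : Summable (completeHomog w q) := by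
  obtain ⟨r, hr1, hr2⟩ := exists_between hwq
  have hlim : Tendsto (fun n : ℕ => r * (1 - q ^ (n + 1))) atTop (𝓝 (r * (1 - 0))) :=
    (((tendsto_pow_atTop_nhds_zero_of_lt_one hq0 hq1).comp (tendsto_add_atTop_nat 1)).const_sub
      1).const_mul r
  rw [sub_zero, mul_one] at hlim
  refine summable_of_ratio_norm_eventually_le hr2 ?_
  filter_upwards [hlim.eventually_const_lt hr1] with n hn
  rw [Real.norm_of_nonneg (completeHomog_nonneg hw hq0 _),
    Real.norm_of_nonneg (completeHomog_nonneg hw hq0 _)]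
  have h1 : 0 < 1 - q ^ (n + 1) := sub_pos.2 (pow_lt_one₀ hq0 hq1 (Nat.succ_ne_zero n))
  refine le_of_mul_le_mul_right ?_ h1
  rw [completeHomog_succ hq0]
  have := mul_le_mul_of_nonneg_right hn.le (completeHomog_nonneg hw hq0 n)
  linarith

/-- Summing the coefficient recursion gives e(w) - e(wq) = w(1-q) e(w). Each use strips one factor
1/(1 - w(1-q)) from the q-exponential. -/
theorem qExp_mul_one_sub {w q : ℝ} (hw : 0 ≤ w) (hq0 : 0 ≤ q) (hq1 : q < 1)
    (hwq : w * (1 - q) < 1) : qExp q w * (1 - w * (1 - q)) = qExp q (w * q) := by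
  have hs := summable_completeHomog hw hq0 hq1 hwq
  have hs' : Summable (completeHomog (w * q) q) := by
    refine Summable.of_nonneg_of_le (completeHomog_nonneg (by positivity) hq0) (fun n => ?_) hs
    rw [completeHomog_mul_pow]
    exact mul_le_of_le_one_left (completeHomog_nonneg hw hq0 n) (pow_le_one₀ hq0 hq1.le)
  have h1 : qExp q w - qExp q (w * q) = w * (1 - q) * qExp q w := by
    rw [qExp, qExp, ← hs.tsum_sub hs', (hs.sub hs').tsum_eq_zero_add, ← tsum_mul_left]
    have h0 : completeHomog w q 0 - completeHomog (w * q) q 0 = 0 := by simp [completeHomog]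
    rw [h0, zero_add]
    refine tsum_congr fun n => ?_
    rw [completeHomog_mul_pow, ← completeHomog_succ hq0]
    ring
  linear_combination h1

theorem one_le_qExp {w q : ℝ} (hw : 0 ≤ w) (hq0 : 0 ≤ q) (hq1 : q < 1)
    (hwq : w * (1 - q) < 1) : 1 ≤ qExp q w := by
  have := (summable_completeHomog hw hq0 hq1 hwq).le_tsum 0
    fun n _ => completeHomog_nonneg hw hq0 n
  simpa [completeHomog, qFact, qExp] using this

theorem qExp_mul_le {w q r : ℝ} (hw : 0 ≤ w) (hq0 : 0 ≤ q) (hq1 : q < 1)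
    (hwq : w * (1 - q) < 1) (hr0 : 0 ≤ r) (hr1 : r ≤ 1) :
    qExp q (w * r) ≤ 1 + r * qExp q w := by
  have hs := summable_completeHomog hw hq0 hq1 hwq
  have hle : ∀ n, completeHomog (w * r) q n ≤
      (if n = 0 then 1 else 0) + r * completeHomog w q n := by
    intro n
    rw [completeHomog_mul_pow]
    have h0 := completeHomog_nonneg hw hq0 n
    split_ifs with hn
    · subst hn
      have : completeHomog w q 0 = 1 := by simp [completeHomog, qFact]
      rw [this]
      linarith [pow_zero r]
    · rw [zero_add]
      exact mul_le_mul_of_nonneg_right (pow_le_of_le_one hr0 hr1 hn) h0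
  have hs1 : HasSum (fun n : ℕ => if n = 0 then (1 : ℝ) else 0) 1 := hasSum_ite_eq 0 1
  have hs2 := hs1.add (hs.hasSum.mul_left r)
  have hs3 : Summable (completeHomog (w * r) q) :=
    Summable.of_nonneg_of_le (completeHomog_nonneg (by positivity) hq0) hle hs2.summable
  exact hasSum_le hle hs3.hasSum hs2

/-- Going from N to N+1, there are N+1 copies of e(w q^N), and the functional equation applies to
each; this produces the exponents n + 1 of the MacMahon product. -/
theorem prod_qExp_mul {w q : ℝ} (hw : 0 ≤ w) (hq0 : 0 ≤ q) (hq1 : q < 1)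
    (hwq : w * (1 - q) < 1) (N : ℕ) :
    (∏ i ∈ range N, qExp q (w * q ^ i)) *
      ∏ n ∈ range N, (1 - w * (1 - q) * q ^ n) ^ (n + 1) = qExp q (w * q ^ N) ^ N := by
  induction N with
  | zero => simp
  | succ N ih =>
    have hle : w * q ^ N * (1 - q) < 1 := by
      have : w * (1 - q) * q ^ N ≤ w * (1 - q) :=
        mul_le_of_le_one_right (mul_nonneg hw (by linarith)) (pow_le_one₀ hq0 hq1.le)
      linarith
    have h1 := qExp_mul_one_sub (w := w * q ^ N) (by positivity) hq0 hq1 hle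
    rw [mul_assoc w (q ^ N) q, ← pow_succ] at h1
    rw [← h1, mul_pow, pow_succ (qExp q (w * q ^ N)), ← ih, Finset.prod_range_succ,
      Finset.prod_range_succ]
    ring

/-- Because e(w q^N) ≤ 1 + q^N e(w), the power lies between 1 and exp(N q^N e(w)), and N q^N → 0. -/
theorem tendsto_qExp_pow {w q : ℝ} (hw : 0 ≤ w) (hq0 : 0 ≤ q) (hq1 : q < 1)
    (hwq : w * (1 - q) < 1) : Tendsto (fun N : ℕ => qExp q (w * q ^ N) ^ N) atTop (𝓝 1) := by
  have h1 : ∀ N : ℕ, 1 ≤ qExp q (w * q ^ N) := by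
    intro N
    refine one_le_qExp (by positivity) hq0 hq1 (lt_of_le_of_lt ?_ hwq)
    rw [mul_right_comm]
    exact mul_le_of_le_one_right (mul_nonneg hw (by linarith)) (pow_le_one₀ hq0 hq1.le)
  have h2 : Tendsto (fun N : ℕ => Real.exp (N * q ^ N * qExp q w)) atTop (𝓝 1) := by
    have := (tendsto_self_mul_const_pow_of_lt_one hq0 hq1).mul_const (qExp q w)
    rw [zero_mul] at this
    have h3 := (Real.continuous_exp.tendsto _).comp this
    rwa [Real.exp_zero] at h3
  refine tendsto_of_tendsto_of_tendsto_of_le_of_le tendsto_const_nhds h2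
    (fun N => one_le_pow₀ (h1 N)) fun N => ?_
  have h3 := qExp_mul_le hw hq0 hq1 hwq (pow_nonneg hq0 N) (pow_le_one₀ hq0 hq1.le)
  have h4 : qExp q (w * q ^ N) ≤ Real.exp (q ^ N * qExp q w) := by
    have := Real.add_one_le_exp (q ^ N * qExp q w)
    linarith
  simp only
  rw [mul_assoc, Real.exp_nat_mul]
  exact pow_le_pow_left₀ (zero_le_one.trans (h1 N)) h4 N

theorem tendsto_prod_macMahon {q t : ℝ} (hq0 : 0 ≤ q) (hq1 : q < 1) (ht0 : 0 ≤ t) (ht1 : t < 1) :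
    Tendsto (fun N => ∏ n ∈ range N, 1 / (1 - t * q ^ n) ^ (n + 1)) atTop
      (𝓝 (∏' n : ℕ, 1 / (1 - t * q ^ n) ^ (n + 1))) := by
  have hlt : ∀ n : ℕ, t * q ^ n ≤ t := fun n =>
    mul_le_of_le_one_right ht0 (pow_le_one₀ hq0 hq1.le)
  have hpos : ∀ n : ℕ, 0 < 1 - t * q ^ n := fun n => by linarith [hlt n]
  refine Multipliable.tendsto_prod_tprod_nat ?_
  refine Real.multipliable_of_summable_log (fun n => by have := hpos n; positivity) ?_
  -- The majorant comes from log x ≤ x - 1 with x - 1 = t q^n / (1 - t q^n) ≤ q^n / (1 - t).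
  have hs : Summable fun n : ℕ => ((n : ℝ) * q ^ n + q ^ n) * (1 / (1 - t)) := by
    refine Summable.mul_right _ (Summable.add ?_ (summable_geometric_of_lt_one hq0 hq1))
    have := summable_pow_mul_geometric_of_norm_lt_one 1 (r := q)
      (by rwa [Real.norm_of_nonneg hq0])
    simpa using this
  have hlog : ∀ n : ℕ, Real.log (1 / (1 - t * q ^ n) ^ (n + 1)) =
      (n + 1) * Real.log (1 / (1 - t * q ^ n)) := by
    intro n
    rw [← one_div_pow, Real.log_pow]
    push_cast
    ring
  refine Summable.of_nonneg_of_le (fun n => ?_) (fun n => ?_) hs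
  · rw [hlog]
    refine mul_nonneg (by positivity) (Real.log_nonneg ?_)
    rw [le_div_iff₀ (hpos n)]
    have : 0 ≤ t * q ^ n := by positivity
    linarith
  · rw [hlog]
    have h1 := Real.log_le_sub_one_of_pos (one_div_pos.2 (hpos n))
    have h2 : 1 / (1 - t * q ^ n) - 1 ≤ q ^ n * (1 / (1 - t)) := by
      have h3 : 1 / (1 - t * q ^ n) - 1 = (t * q ^ n) / (1 - t * q ^ n) := by
        have := (hpos n).ne'
        field_simp
        ring
      rw [h3, mul_one_div]
      refine div_le_div₀ (by positivity) ?_ (by linarith) (by linarith [hlt n])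
      exact mul_le_of_le_one_left (by positivity) ht1.le
    have h4 := mul_le_mul_of_nonneg_left (h1.trans h2) (by positivity : (0 : ℝ) ≤ n + 1)
    refine h4.trans (le_of_eq (by ring))

theorem hasSum_squared_of_pos {q t : ℝ} (hq0 : 0 < q) (hq1 : q < 1) (ht0 : 0 ≤ t) (ht1 : t < 1) :
    HasSum (fun lam => schurWeight (1 / (1 - q)) q lam * schurWeight (t / (1 - q)) q lam)
      (∏' n : ℕ, 1 / (1 - t * q ^ n) ^ (n + 1)) := by
  have hpos : 0 < 1 - q := by linarith
  set w := t / (1 - q) with hw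
  have hwt : w * (1 - q) = t := div_mul_cancel₀ t hpos.ne'
  have hw0 : 0 ≤ w := by positivity
  refine hasSum_schurWeight_mul hq0 hq1 hq0.le hw0 (qExp q) ?_ ?_
  · intro v hv hvw
    refine (summable_completeHomog hv hq0.le hq1 ?_).hasSum
    have := mul_le_mul_of_nonneg_right hvw hpos.le
    linarith
  · have h1 := (tendsto_qExp_pow hw0 hq0.le hq1 (by rwa [hwt])).mul
      (tendsto_prod_macMahon hq0.le hq1 ht0 ht1)
    rw [one_mul] at h1
    refine h1.congr fun N => ?_
    rw [← prod_qExp_mul hw0 hq0.le hq1 (by rwa [hwt]), hwt, Finset.prod_div_distrib,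
      Finset.prod_const_one]
    have : ∏ n ∈ range N, (1 - t * q ^ n) ^ (n + 1) ≠ 0 := by
      refine Finset.prod_ne_zero_iff.2 fun n _ => pow_ne_zero _ ?_
      have : t * q ^ n ≤ t := mul_le_of_le_one_right ht0 (pow_le_one₀ hq0.le hq1.le)
      linarith
    field_simp

/-! ### Comparison in q, square summability and boundary cases -/

theorem schurWeight_div_eq {q : ℝ} (hq1 : q < 1) (s : ℝ) (lam : YoungDiagram) :
    schurWeight (s / (1 - q)) q lam =
      s ^ lam.card * q ^ bStat lam * ∏ c ∈ lam.cells, 1 / (1 - q ^ hookLength lam c) := by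
  have hpos : 0 < 1 - q := by linarith
  have h1 : ∏ c ∈ lam.cells, 1 / (1 - q ^ hookLength lam c) =
      (1 / (1 - q)) ^ lam.card * ∏ c ∈ lam.cells, 1 / qNum q (hookLength lam c) := by
    rw [YoungDiagram.card, ← Finset.prod_const, ← Finset.prod_mul_distrib]
    refine Finset.prod_congr rfl fun c _ => ?_
    rw [← one_sub_mul_qNum, one_div_mul_one_div]
  rw [h1, schurWeight, hookWeight, div_eq_mul_one_div, mul_pow]
  ring

/-- Raising q increases q^b(λ) and decreases every 1 - q^h. This supplies the domination needed to
reach q = 0 from positive q. -/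
theorem schurWeight_div_mono {q r s : ℝ} (hq0 : 0 ≤ q) (hqr : q ≤ r) (hr1 : r < 1) (hs : 0 ≤ s)
    (lam : YoungDiagram) :
    schurWeight (s / (1 - q)) q lam ≤ schurWeight (s / (1 - r)) r lam := by
  rw [schurWeight_div_eq (hqr.trans_lt hr1), schurWeight_div_eq hr1]
  have hpos : ∀ c ∈ lam.cells, 0 < 1 - r ^ hookLength lam c := fun c hc =>
    sub_pos.2 (pow_lt_one₀ (hq0.trans hqr) hr1 (hookLength_pos hc).ne')
  have hle : ∀ c ∈ lam.cells, 1 - r ^ hookLength lam c ≤ 1 - q ^ hookLength lam c := fun c _ =>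
    sub_le_sub_left (pow_le_pow_left₀ hq0 hqr _) 1
  refine mul_le_mul ?_ (Finset.prod_le_prod (fun c hc => ?_) fun c hc => ?_)
    (Finset.prod_nonneg fun c hc => ?_) (by have := hq0.trans hqr; positivity)
  · exact mul_le_mul_of_nonneg_left (pow_le_pow_left₀ hq0 hqr _) (by positivity)
  · exact one_div_nonneg.2 ((hpos c hc).le.trans (hle c hc))
  · exact one_div_le_one_div_of_le (hpos c hc) (hle c hc)
  · exact one_div_nonneg.2 ((hpos c hc).le.trans (hle c hc))

/-- Lets the parameters be shifted between the two factors, so that both become square summable. -/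
theorem schurWeight_mul_schurWeight (x y x' y' q p : ℝ) (h : x * y = x' * y')
    (lam : YoungDiagram) :
    schurWeight x q lam * schurWeight y p lam = schurWeight x' q lam * schurWeight y' p lam := by
  have h1 : x ^ lam.card * y ^ lam.card = x' ^ lam.card * y' ^ lam.card := by
    rw [← mul_pow, h, mul_pow]
  simp only [schurWeight]
  linear_combination hookWeight q lam * hookWeight p lam * h1

/-- After rebalancing, the sum of squares is the squared-type Cauchy sum with t = s². That identity
needs q > 0, so q is first raised to at least 1/2. -/
theorem summable_sq_schurWeight {q s : ℝ} (hq0 : 0 ≤ q) (hq1 : q < 1) (hs0 : 0 ≤ s)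
    (hs1 : s < 1) : Summable fun lam => schurWeight (s / (1 - q)) q lam ^ 2 := by
  set r := max q (1 / 2) with hr
  have hqr : q ≤ r := le_max_left _ _
  have hr0 : 0 < r := lt_of_lt_of_le (by norm_num) (le_max_right q (1 / 2))
  have hr1 : r < 1 := max_lt hq1 (by norm_num)
  have hpos : 0 < 1 - q := by linarith
  have h1 := (hasSum_squared_of_pos hr0 hr1 (sq_nonneg s) (by nlinarith)).summable
  refine Summable.of_nonneg_of_le (fun lam => sq_nonneg _) (fun lam => ?_) h1
  have h2 := schurWeight_div_mono hq0 hqr hr1 hs0 lam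
  have h3 := schurWeight_nonneg (by positivity : 0 ≤ s / (1 - q)) hq0 lam
  rw [schurWeight_mul_schurWeight (1 / (1 - r)) (s ^ 2 / (1 - r)) (s / (1 - r)) (s / (1 - r))
    r r (by ring), ← pow_two]
  exact pow_le_pow_left₀ h3 h2 2

/-- The Cauchy identity for a principal and a Plancherel specialization. -/
theorem hasSum_mixed {q z : ℝ} (hq0 : 0 ≤ q) (hq1 : q < 1) (hz : 0 ≤ z) :
    HasSum (fun lam => schurWeight (1 / (1 - q)) q lam * schurWeight z 1 lam)
      (Real.exp (z / (1 - q))) := by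
  rcases hq0.eq_or_lt with rfl | hq0
  swap
  · exact hasSum_mixed_of_pos hq0 hq1 hz
  have hz1 : ∀ lam, 0 ≤ schurWeight z 1 lam := schurWeight_nonneg hz zero_le_one
  have hw : ∀ q : ℝ, 0 ≤ q → q < 1 → ∀ lam, 0 ≤ schurWeight (1 / (1 - q)) q lam := fun q h h1 lam =>
    schurWeight_nonneg (one_div_nonneg.2 (by linarith)) h lam
  -- The remaining case q = 0 is the limit q → 0⁺, dominated by the terms at q = 1/2.
  have hhalf := (hasSum_mixed_of_pos (q := 1 / 2) (by norm_num) (by norm_num) hz).summable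
  have hle : ∀ q : ℝ, 0 ≤ q → q ≤ 1 / 2 → ∀ lam,
      schurWeight (1 / (1 - q)) q lam * schurWeight z 1 lam ≤
      schurWeight (1 / (1 - 1 / 2)) (1 / 2) lam * schurWeight z 1 lam := fun q h h1 lam =>
    mul_le_mul_of_nonneg_right (schurWeight_div_mono h h1 (by norm_num) zero_le_one lam) (hz1 lam)
  have hs : Summable (fun lam => schurWeight (1 / (1 - 0)) 0 lam * schurWeight z 1 lam) :=
    Summable.of_nonneg_of_le (fun lam => mul_nonneg (hw 0 le_rfl hq1 lam) (hz1 lam))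
      (hle 0 le_rfl (by norm_num)) hhalf
  have hsmall : ∀ᶠ q : ℝ in 𝓝[>] 0, 0 < q ∧ q ≤ 1 / 2 := by
    filter_upwards [Ioc_mem_nhdsGT (show (0 : ℝ) < 1 / 2 by norm_num)] with q hq using hq
  have h1 : Tendsto (fun q : ℝ => ∑' lam, schurWeight (1 / (1 - q)) q lam * schurWeight z 1 lam)
      (𝓝[>] 0) (𝓝 (∑' lam, schurWeight (1 / (1 - 0)) 0 lam * schurWeight z 1 lam)) := by
    refine tendsto_tsum_of_dominated_convergence hhalf (fun lam => ?_) ?_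
    · refine Tendsto.mul_const _ ?_
      unfold schurWeight
      refine Tendsto.mul ?_ ?_
      · have : ContinuousAt (fun q : ℝ => (1 / (1 - q)) ^ lam.card) 0 := by
          refine ContinuousAt.pow (ContinuousAt.div continuousAt_const (by fun_prop) (by norm_num)) _
        exact this.tendsto.mono_left nhdsWithin_le_nhds
      · exact ((continuousOn_hookWeight lam) 0 Set.self_mem_Ici).mono_left
          (nhdsWithin_mono 0 Set.Ioi_subset_Ici_self)
    · filter_upwards [hsmall] with q hq lam
      rw [Real.norm_of_nonneg (mul_nonneg (hw q hq.1.le (by linarith) lam) (hz1 lam))]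
      exact hle q hq.1.le hq.2 lam
  have h2 : Tendsto (fun q : ℝ => Real.exp (z / (1 - q))) (𝓝[>] 0)
      (𝓝 (Real.exp (z / (1 - 0)))) := by
    have : ContinuousAt (fun q : ℝ => Real.exp (z / (1 - q))) 0 := by
      refine ContinuousAt.rexp (ContinuousAt.div continuousAt_const (by fun_prop) (by norm_num))
    exact this.tendsto.mono_left nhdsWithin_le_nhds
  have h3 : (fun q : ℝ => ∑' lam, schurWeight (1 / (1 - q)) q lam * schurWeight z 1 lam) =ᶠ[𝓝[>] 0]
      fun q => Real.exp (z / (1 - q)) := by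
    filter_upwards [hsmall] with q hq
    exact (hasSum_mixed_of_pos hq.1 (by linarith) hz).tsum_eq
  rw [tendsto_nhds_unique (h2.congr' h3.symm) h1]
  exact hs.hasSum

/-- In the mixed identity at q < 1, take z = y²(1-q), which rebalances to the parameters y and y.
The total is exp(y²) for every q, so finite sums keep this bound as q → 1⁻. -/
theorem summable_sq_schurWeight_one (y : ℝ) :
    Summable fun lam => schurWeight y 1 lam ^ 2 := by
  refine summable_of_sum_le (c := Real.exp (y ^ 2)) (fun lam => sq_nonneg _) fun T => ?_
  have h1 : Tendsto (fun q : ℝ => ∑ lam ∈ T, schurWeight y q lam * schurWeight y 1 lam)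
      (𝓝[<] 1) (𝓝 (∑ lam ∈ T, schurWeight y 1 lam * schurWeight y 1 lam)) := by
    refine tendsto_finsetSum _ fun lam _ => Tendsto.mul_const _ (Tendsto.const_mul _ ?_)
    have : ContinuousAt (fun q => hookWeight q lam) 1 :=
      (continuousOn_hookWeight lam).continuousAt (Ici_mem_nhds zero_lt_one)
    exact this.tendsto.mono_left nhdsWithin_le_nhds
  simp only [← pow_two] at h1
  refine le_of_tendsto h1 ?_
  filter_upwards [Ioo_mem_nhdsLT (show (0 : ℝ) < 1 by norm_num)] with q hq
  have hpos : 0 < 1 - q := by linarith [hq.2]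
  have hz : 0 ≤ y ^ 2 * (1 - q) := by positivity
  have h2 := hasSum_mixed_of_pos hq.1 hq.2 hz
  rw [mul_div_assoc, div_self hpos.ne', mul_one] at h2
  refine le_trans (le_of_eq (Finset.sum_congr rfl fun lam _ => ?_)) (sum_le_hasSum T
    (fun lam _ => mul_nonneg (schurWeight_nonneg (by positivity) hq.1.le lam)
      (schurWeight_nonneg hz zero_le_one lam)) h2)
  refine schurWeight_mul_schurWeight _ _ _ _ _ _ ?_ lam
  field_simp

theorem hasSum_squared {q ξ : ℝ} (hq0 : 0 ≤ q) (hq1 : q < 1) (hξ0 : 0 ≤ ξ) (hξ1 : ξ < 1) :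
    HasSum (fun lam => schurWeight (1 / (1 - q)) q lam * schurWeight (ξ ^ 2 * q / (1 - q)) q lam)
      (modMacMahon ξ q) := by
  rcases hq0.eq_or_lt with rfl | hq0
  · have h1 : modMacMahon ξ 0 = 1 := by simp [modMacMahon]
    rw [h1]
    -- At q = 0 the second parameter is 0, so only the empty partition has mass.
    have h2 := hasSum_single (f := fun lam => schurWeight (1 / (1 - 0)) 0 lam *
      schurWeight (ξ ^ 2 * 0 / (1 - 0)) 0 lam) ⊥ (fun lam hlam => by
        have hc : lam.card ≠ 0 := fun h => hlam (YoungDiagram.ext (Finset.card_eq_zero.1 h))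
        have : schurWeight (ξ ^ 2 * 0 / (1 - 0)) 0 lam = 0 := by
          simp [schurWeight, zero_pow hc]
        rw [this, mul_zero])
    simpa only [schurWeight_bot, mul_one] using h2
  · have h1 := hasSum_squared_of_pos hq0 hq1 (t := ξ ^ 2 * q) (by positivity)
      (by nlinarith [mul_nonneg hξ0 hq0.le])
    have h2 : modMacMahon ξ q = ∏' n : ℕ, 1 / (1 - ξ ^ 2 * q * q ^ n) ^ (n + 1) := by
      rw [modMacMahon]
      refine tprod_congr fun n => ?_
      rw [pow_succ' q n, mul_assoc]
    rw [h2]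
    exact h1

/-! ### From sums over partitions to measures -/

theorem partitionMeasure_apply (w : YoungDiagram → ℝ) (A : Set YoungDiagram) :
    partitionMeasure w A = ∑' lam, open scoped Classical in
      ENNReal.ofReal (if lam ∈ A then w lam else 0) := by
  classical
  have hA : MeasurableSet A := trivial
  rw [partitionMeasure, Measure.sum_apply _ hA]
  refine tsum_congr fun lam => ?_
  rw [Measure.smul_apply, Measure.dirac_apply' _ hA, smul_eq_mul]
  by_cases h : lam ∈ A <;> simp [h]

theorem partitionMeasure_apply_of_hasSum {w : YoungDiagram → ℝ} (hw : ∀ lam, 0 ≤ w lam)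
    {A : Set YoungDiagram} {a : ℝ}
    (h : HasSum (fun lam => open scoped Classical in if lam ∈ A then w lam else 0) a) :
    partitionMeasure w A = ENNReal.ofReal a := by
  classical
  rw [partitionMeasure_apply, ← h.tsum_eq, ENNReal.ofReal_tsum_of_nonneg _ h.summable]
  intro lam
  split_ifs
  exacts [hw lam, le_rfl]

theorem isProbabilityMeasure_partitionMeasure {w : YoungDiagram → ℝ} (hw : ∀ lam, 0 ≤ w lam)
    (h : HasSum w 1) : IsProbabilityMeasure (partitionMeasure w) := by
  refine ⟨?_⟩
  rw [partitionMeasure_apply_of_hasSum hw (a := 1) (by simpa using h), ENNReal.ofReal_one]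

theorem measurable_configuration : Measurable configuration := measurable_from_top

theorem isDiscreteDeterminantal_configurationLaw {w : YoungDiagram → ℝ} (hw : ∀ lam, 0 ≤ w lam)
    (h : HasSum w 1) (K : HalfInt → HalfInt → ℝ)
    (hK : ∀ (k : ℕ) (z : Fin k ↪ HalfInt), HasSum (fun lam => open scoped Classical in
      if Set.range z ⊆ configuration lam then w lam else 0)
        (Matrix.of fun i j => K (z i) (z j)).det) :
    IsDiscreteDeterminantal (configurationLaw (partitionMeasure w)) := by
  have := isProbabilityMeasure_partitionMeasure hw h
  refine ⟨Measure.isProbabilityMeasure_map measurable_configuration.aemeasurable,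
    fun a b => (K a b : ℂ), fun k z => ?_⟩
  have hmeas : MeasurableSet {S : Set HalfInt | ((univ.map z : Finset HalfInt) : Set HalfInt) ⊆ S} := by
    have : {S : Set HalfInt | ((univ.map z : Finset HalfInt) : Set HalfInt) ⊆ S} =
        ⋂ i, {S : Set HalfInt | z i ∈ S} := by
      ext S
      simp [Set.range_subset_iff]
    rw [this]
    exact MeasurableSet.iInter fun i => measurableSet_setOfPred.2 (measurable_set_mem (z i))
  have h1 : correlationFunction (configurationLaw (partitionMeasure w)) (univ.map z) =
      (Matrix.of fun i j => K (z i) (z j)).det := by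
    rw [correlationFunction, configurationLaw, Measure.real,
      Measure.map_apply measurable_configuration hmeas,
      partitionMeasure_apply_of_hasSum hw (a := (Matrix.of fun i j => K (z i) (z j)).det) ?_,
      ENNReal.toReal_ofReal]
    · refine (hK k z).nonneg fun lam => ?_
      split_ifs
      exacts [hw lam, le_rfl]
    · have hr : ((univ.map z : Finset HalfInt) : Set HalfInt) = Set.range z := by simp
      rw [hr]
      exact hK k z
  rw [h1]
  have h2 := RingHom.map_det Complex.ofRealHom (Matrix.of fun i j => K (z i) (z j))
  exact h2

theorem schurWeight_measure {x q y p Z : ℝ} (hx : 0 ≤ x) (hq : 0 ≤ q) (hy : 0 ≤ y) (hp : 0 ≤ p)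
    (hsum : HasSum (fun lam => schurWeight x q lam * schurWeight y p lam) Z)
    (hxq : Summable fun lam => schurWeight x q lam ^ 2)
    (hyp : Summable fun lam => schurWeight y p lam ^ 2) {w : YoungDiagram → ℝ}
    (hw : ∀ lam, w lam = Z⁻¹ * (schurWeight x q lam * schurWeight y p lam)) :
    IsProbabilityMeasure (partitionMeasure w) ∧
      IsDiscreteDeterminantal (configurationLaw (partitionMeasure w)) := by
  classical
  obtain rfl : w = fun lam => Z⁻¹ * (schurWeight x q lam * schurWeight y p lam) := funext hw
  have hnn : ∀ lam, 0 ≤ schurWeight x q lam * schurWeight y p lam := fun lam =>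
    mul_nonneg (schurWeight_nonneg hx hq lam) (schurWeight_nonneg hy hp lam)
  have hZ : 0 < Z := by
    have := le_hasSum hsum ⊥ fun lam _ => hnn lam
    rw [schurWeight_bot, schurWeight_bot] at this
    linarith
  have hwnn : ∀ lam, 0 ≤ Z⁻¹ * (schurWeight x q lam * schurWeight y p lam) := fun lam =>
    mul_nonneg (inv_nonneg.2 hZ.le) (hnn lam)
  have hone : HasSum (fun lam => Z⁻¹ * (schurWeight x q lam * schurWeight y p lam)) 1 := by
    rw [← inv_mul_cancel₀ hZ.ne']
    exact hsum.mul_left Z⁻¹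
  refine ⟨isProbabilityMeasure_partitionMeasure hwnn hone, ?_⟩
  obtain ⟨K, hK⟩ := exists_kernel_schurWeight hx hq hy hp hsum hxq hyp
  refine isDiscreteDeterminantal_configurationLaw hwnn hone K fun k z => ?_
  have h1 := (hK k z).mul_left Z⁻¹
  rw [inv_mul_cancel_left₀ hZ.ne'] at h1
  simpa only [mul_ite, mul_zero] using h1

theorem hookWeight_one (lam : YoungDiagram) :
    hookWeight 1 lam = ∏ c ∈ lam.cells, 1 / (hookLength lam c : ℝ) := by
  simp [hookWeight, qNum]

theorem squaredWeight_eq {q ξ : ℝ} (hq1 : q < 1) (lam : YoungDiagram) :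
    squaredWeight ξ q lam = (modMacMahon ξ q)⁻¹ *
      (schurWeight (1 / (1 - q)) q lam * schurWeight (ξ ^ 2 * q / (1 - q)) q lam) := by
  rw [schurWeight_div_eq hq1, schurWeight_div_eq hq1, squaredWeight]
  simp only [← one_div_pow, Finset.prod_pow]
  ring

theorem mixedWeight_eq {q ξ : ℝ} (hq1 : q < 1) (lam : YoungDiagram) :
    mixedWeight ξ q lam = (Real.exp (ξ ^ 2 / (1 - q)))⁻¹ *
      (schurWeight (1 / (1 - q)) q lam * schurWeight (ξ ^ 2) 1 lam) := by
  rw [schurWeight_div_eq hq1, schurWeight, hookWeight_one, mixedWeight, Real.exp_neg]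
  simp only [← one_div_mul_one_div, Finset.prod_mul_distrib]
  ring

theorem squaredQPlancherel_properties {q ξ : ℝ} (hq0 : 0 ≤ q) (hq1 : q < 1) (hξ0 : 0 ≤ ξ)
    (hξ1 : ξ < 1) : IsProbabilityMeasure (squaredQPlancherel ξ q) ∧
      IsDiscreteDeterminantal (configurationLaw (squaredQPlancherel ξ q)) := by
  have hpos : 0 < 1 - q := by linarith
  have hs1 : ξ * √q < 1 := by
    have h1 : √q ≤ 1 := Real.sqrt_le_one.2 hq1.le
    exact (mul_le_of_le_one_right hξ0 h1).trans_lt hξ1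
  have hs := summable_sq_schurWeight hq0 hq1 (by positivity : 0 ≤ ξ * √q) hs1
  -- The parameters 1 and ξ² q are replaced by their geometric mean ξ√q < 1; square summability is
  -- available only for s < 1, which excludes the original parameter 1.
  have hmul : 1 / (1 - q) * (ξ ^ 2 * q / (1 - q)) =
      ξ * √q / (1 - q) * (ξ * √q / (1 - q)) := by
    field_simp
    rw [Real.sq_sqrt hq0, mul_comm]
  have hsum := hasSum_squared hq0 hq1 hξ0 hξ1
  simp only [schurWeight_mul_schurWeight _ _ _ _ q q hmul] at hsum
  refine schurWeight_measure (by positivity) hq0 (by positivity) hq0 hsum hs hs fun lam => ?_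
  rw [squaredWeight_eq hq1, schurWeight_mul_schurWeight _ _ _ _ q q hmul]

theorem mixedQPlancherel_properties {q ξ : ℝ} (hq0 : 0 ≤ q) (hq1 : q < 1) (hξ0 : 0 ≤ ξ)
    (hξ1 : ξ < 1) : IsProbabilityMeasure (mixedQPlancherel ξ q) ∧
      IsDiscreteDeterminantal (configurationLaw (mixedQPlancherel ξ q)) := by
  have hpos : 0 < 1 - q := by linarith
  -- Splitting ξ² evenly makes the principal parameter s = ξ < 1; the Plancherel factor is square
  -- summable for any parameter.
  have hmul : 1 / (1 - q) * ξ ^ 2 = ξ / (1 - q) * ξ := by ring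
  have hsum := hasSum_mixed hq0 hq1 (sq_nonneg ξ)
  simp only [schurWeight_mul_schurWeight _ _ _ _ q 1 hmul] at hsum
  refine schurWeight_measure (by positivity) hq0 hξ0 zero_le_one hsum
    (summable_sq_schurWeight hq0 hq1 hξ0 hξ1) (summable_sq_schurWeight_one ξ) fun lam => ?_
  rw [mixedWeight_eq hq1, schurWeight_mul_schurWeight _ _ _ _ q 1 hmul]

end

theorem corollary2 (q ξ : ℝ) (hq : q ∈ Set.Ico (0 : ℝ) 1) (hξ : ξ ∈ Set.Ico (0 : ℝ) 1) :
    IsProbabilityMeasure (squaredQPlancherel ξ q) ∧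
    IsProbabilityMeasure (mixedQPlancherel ξ q) ∧
    IsDiscreteDeterminantal (configurationLaw (squaredQPlancherel ξ q)) ∧
    IsDiscreteDeterminantal (configurationLaw (mixedQPlancherel ξ q)) := by
  obtain ⟨hS, hS'⟩ := squaredQPlancherel_properties hq.1 hq.2 hξ.1 hξ.2
  obtain ⟨hM, hM'⟩ := mixedQPlancherel_properties hq.1 hq.2 hξ.1 hξ.2
  exact ⟨hS, hM, hS', hM'⟩
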